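/- Let $H$ be a complex Hilbert space and let $M\subset B(H)$ be a von Neumann algebra (containing the identity of $B(H)$). Let $M\otimes M\subset B(H\otimes H)$ be its von Neumann tensor square, i.e. the von Neumann algebra generated by the operators $a\otimes b$ $(a,b\in M)$ on the Hilbert space tensor product $H\otimes H$. Let $$\lambda(M)=\inf\{\|P\| : P\colon B(H)\to M \text{ a bounded linear projection onto } M\}\in[0,\infty],$$ with $\lambda(M)=\infty$ if there is no such projection. Assume that $M$ is $*$-isomorphic to $M\otimes M$ or, more generally, only that $M\otimes M$ embeds in $M$ as a contractively complemented subalgebra, i.e. that there are an injective $*$-homomorphism $\pi\colon M\otimes M\to M$ and a linear projection of norm at most $1$ from $M$ onto $\pi(M\otimes M)$. Then: 1. If there is a bounded linear projection from $B(H)$ onto $M$, then there is a linear projection from $B(H)$ onto $M$ of norm at most $1$, and $M$ is injective: for all unital $C^*$-algebras $A\subset B$ with the same unit, every completely positive map $A\to M$ extends to a completely positive map $B\to M$. 2. If $H\neq 0$, then $\lambda(M)=1$ or $\lambda(M)=\infty$. -/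

import Mathlib

open scoped TensorProduct ENNReal CStarAlgebra

universe u v w

noncomputable section

section BanachSpaces

variable {E : Type*} [NormedAddCommGroup E] [NormedSpace ℂ E]

/-- The projection constant `λ(S, E)`: the infimum of the norms of the bounded linear projections
of `E` onto its subspace `S`; it is `∞` when there is no such projection. -/
def projectionConstant (S : Submodule ℂ E) : ℝ≥0∞ :=
  ⨅ (P : E →L[ℂ] S) (_ : ∀ x : S, P x = x), ‖P‖ₑ

/-- The subspace `S` of `E` is contractively complemented: there is a linear projection of `E`
onto `S` of norm at most one. (Mathlib's `Submodule.ClosedComplemented` is complementation by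
a bounded projection.) -/
def ContractivelyComplemented (S : Submodule ℂ E) : Prop :=
  ∃ P : E →L[ℂ] S, (∀ x : S, P x = x) ∧ ‖P‖ ≤ 1

end BanachSpaces

section HilbertTensor

/-- The Hilbert space tensor product: the completion of the algebraic tensor product for the
inner product with `⟪x ⊗ y, x' ⊗ y'⟫ = ⟪x, x'⟫ ⟪y, y'⟫`. -/
abbrev HilbertTensor (H K : Type*) [NormedAddCommGroup H] [InnerProductSpace ℂ H]
    [NormedAddCommGroup K] [InnerProductSpace ℂ K] : Type _ :=
  UniformSpace.Completion (H ⊗[ℂ] K)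

variable {H : Type u} [NormedAddCommGroup H] [InnerProductSpace ℂ H]
variable {K : Type v} [NormedAddCommGroup K] [InnerProductSpace ℂ K]

/-- The bounded operator `a ⊗ b` on the Hilbert space tensor product. -/
def operatorTensor (a : H →L[ℂ] H) (b : K →L[ℂ] K) :
    HilbertTensor H K →L[ℂ] HilbertTensor H K :=
  (TensorProduct.mapL a b).completion

theorem operatorTensor_tmul (a : H →L[ℂ] H) (b : K →L[ℂ] K) (x : H) (y : K) :
    operatorTensor a b ((x ⊗ₜ[ℂ] y : H ⊗[ℂ] K) : HilbertTensor H K) =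
      ((a x ⊗ₜ[ℂ] b y : H ⊗[ℂ] K) : HilbertTensor H K) := by
  simp [operatorTensor]

end HilbertTensor

namespace VonNeumannAlgebra

section Defs

variable {H : Type u} [NormedAddCommGroup H] [InnerProductSpace ℂ H] [CompleteSpace H]
variable {K : Type v} [NormedAddCommGroup K] [InnerProductSpace ℂ K] [CompleteSpace K]

/-- The von Neumann algebra generated by a set `s` of bounded operators: the bicommutant of
`s ∪ s*`. -/
def generatedBy (s : Set (H →L[ℂ] H)) : VonNeumannAlgebra H where
  toStarSubalgebra :=
    StarSubalgebra.centralizer ℂ (StarSubalgebra.centralizer ℂ s : Set (H →L[ℂ] H))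
  centralizer_centralizer' := by simp

theorem coe_generatedBy (s : Set (H →L[ℂ] H)) :
    (generatedBy s : Set (H →L[ℂ] H)) = Set.centralizer (Set.centralizer (s ∪ star s)) :=
  StarSubalgebra.coe_centralizer_centralizer ℂ s

/-- The von Neumann algebra tensor product `M ⊗ N` on the Hilbert space `H ⊗ K`, generated by the
operators `a ⊗ b` with `a ∈ M` and `b ∈ N`. -/
def tensor (M : VonNeumannAlgebra H) (N : VonNeumannAlgebra K) :
    VonNeumannAlgebra (HilbertTensor H K) :=
  generatedBy {T | ∃ a ∈ M, ∃ b ∈ N, T = operatorTensor a b}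

theorem operatorTensor_mem_tensor {M : VonNeumannAlgebra H} {N : VonNeumannAlgebra K}
    {a : H →L[ℂ] H} {b : K →L[ℂ] K} (ha : a ∈ M) (hb : b ∈ N) :
    operatorTensor a b ∈ M.tensor N := by
  rw [← SetLike.mem_coe, tensor, coe_generatedBy]
  exact Set.subset_centralizer_centralizer (Or.inl ⟨a, ha, b, hb, rfl⟩)

/-- The underlying linear subspace of `B(H)`. -/
def toSubspace (M : VonNeumannAlgebra H) : Submodule ℂ (H →L[ℂ] H) :=
  Subalgebra.toSubmodule M.toStarSubalgebra.toSubalgebra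

/-- `N` embeds in `M` as a contractively complemented subalgebra: there is an injective
`*`-homomorphism `N → M` (neither unital nor normal by assumption) onto whose range there is
a projection of `M` of norm at most one. -/
def EmbedsContractivelyComplemented (N : VonNeumannAlgebra K) (M : VonNeumannAlgebra H) : Prop :=
  ∃ π : N.toStarSubalgebra →⋆ₙₐ[ℂ] M.toStarSubalgebra, Function.Injective π ∧
    ContractivelyComplemented (NonUnitalStarAlgHom.range π).toSubmodule

/-- Injectivity of `M`: whenever `A` is a unital C⋆-subalgebra of a C⋆-algebra `B` (through `ι`),
every completely positive map `A → M` extends to a completely positive map `B → M`. Maps into `M`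
are maps into `B(H)` with values in `M`; the positivity of matrices over `M` is the same over
`B(H)`. -/
def IsInjective (M : VonNeumannAlgebra H) : Prop :=
  ∀ (A B : Type w) [CStarAlgebra A] [PartialOrder A] [StarOrderedRing A]
    [CStarAlgebra B] [PartialOrder B] [StarOrderedRing B]
    (ι : A →⋆ₐ[ℂ] B), Function.Injective ι →
    ∀ φ : A →CP (H →L[ℂ] H), (∀ a, φ a ∈ M) →
      ∃ ψ : B →CP (H →L[ℂ] H), (∀ b, ψ b ∈ M) ∧ ∀ a, ψ (ι a) = φ a

end Defs

end VonNeumannAlgebra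

end

/-! The heart is the inequality `λ(M ⊗ M) ≥ λ(M)²`. Since `M ⊗ M` sits contractively complemented in
`M`, also `λ(M ⊗ M) ≤ λ(M)`. A finite `λ(M)` thus satisfies `λ² ≤ λ`, so `λ ≤ 1`, and the infimum is
attained.

Both the inequality and attainment come from duality. Linear maps `T : B(H) → B(H)` are paired with
formal sums `v` of triples `(b, ξ, η)` through `⟪η, T b ξ⟫`. On the `v` in `determinedTriples` all
projections onto `M` take the same value `⟨E, v⟩`. By Hahn–Banach (`hasProjection_of_forall_le`) a
projection of norm at most `C` exists once `|⟨E, v⟩| ≤ C‖v‖` for these `v`. Let `P` be a projection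
onto `M ⊗ M` of norm at most `C`. If the bound with `√C` fails at some `v`, then slicing `P (x ⊗ b)`
in the second variable along `v` gives a map `B(H) → M` of norm at most `C‖v‖`, equal to `⟨E, v⟩`
times the identity on `M` (`sliceSum_eq_smul`). Dividing by `⟨E, v⟩` gives a projection of norm at
most `√C`. Either way `HasProjection.of_tensor` holds.

Arveson's theorem (`CompletelyPositiveMap.exists_extension`) serves twice: it extends `π : M ⊗ M → M
⊆ B(H)` to a contraction on `B(H ⊗ H)`, which transfers projections from `M` to `M ⊗ M`. Together
with Tomiyama's theorem, by which a contractive projection is completely positive, it also gives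
injectivity. -/

noncomputable section

/-! ### Positivity of matrices over C⋆-algebras -/

/-- The negative part of a self-adjoint element. -/
theorem IsSelfAdjoint.exists_nonneg_mul_eq_neg_mul_self {A : Type*} [NonUnitalCStarAlgebra A]
    [PartialOrder A] [StarOrderedRing A] {x : A} (hx : IsSelfAdjoint x) :
    ∃ y : A, 0 ≤ y ∧ x * y = -(y * y) ∧ (y = 0 → 0 ≤ x) := by
  refine ⟨x⁻, CFC.negPart_nonneg x, ?_, fun h => ?_⟩
  · nth_rewrite 1 [← CFC.posPart_sub_negPart x hx]
    rw [sub_mul, CFC.posPart_mul_negPart, zero_sub]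
  · rw [← CFC.posPart_sub_negPart x hx, h, sub_zero]
    exact CFC.posPart_nonneg x

theorem exists_eq_star_mul_self_of_nonneg {A : Type*} [NonUnitalCStarAlgebra A]
    [PartialOrder A] [StarOrderedRing A] {x : A} (hx : 0 ≤ x) : ∃ s : A, x = star s * s :=
  CStarAlgebra.nonneg_iff_eq_star_mul_self.mp hx

namespace CStarMatrix

variable {A : Type*} [CStarAlgebra A] [PartialOrder A] [StarOrderedRing A]
variable {n : Type*} [Fintype n]

/-- A self-adjoint matrix over a C⋆-algebra is positive if its quadratic form is. -/
theorem nonneg_of_forall_sum {X : CStarMatrix n n A} (hX : IsSelfAdjoint X)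
    (h : ∀ r : n → A, 0 ≤ ∑ i, ∑ j, star (r i) * X i j * r j) : 0 ≤ X := by
  classical
  obtain ⟨Y, hY, hXY, hX0⟩ := hX.exists_nonneg_mul_eq_neg_mul_self
  obtain ⟨S, hS⟩ := exists_eq_star_mul_self_of_nonneg hY
  have hsa : star Y = Y := (IsSelfAdjoint.of_nonneg hY).star_eq
  -- Compressing `X` by its negative part `Y` gives `-Y³ ≤ 0`. The diagonal entries are values of
  -- the form at the columns of `Y`, hence also `≥ 0`. So they vanish, which forces `S * Y = 0` and
  -- `Y = 0`.
  have key : star Y * X * Y = -(star (S * Y) * (S * Y)) := by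
    rw [mul_assoc, hXY, star_mul, hsa]
    conv_rhs => rw [mul_assoc, ← mul_assoc (star S), ← hS]
    rw [mul_neg]
  have hSY : S * Y = 0 := by
    ext k j
    have h1 : (star Y * X * Y) j j = ∑ i, ∑ l, star (Y i j) * X i l * Y l j := by
      simp only [CStarMatrix.mul_apply, Finset.sum_mul, CStarMatrix.star_apply]
      rw [Finset.sum_comm]
    have h2 : (star (S * Y) * (S * Y)) j j =
        ∑ i, star ((S * Y) i j) * (S * Y) i j := by
      rw [CStarMatrix.mul_apply]
      simp only [CStarMatrix.star_apply]
    have h3 := h fun i => Y i j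
    rw [← h1, key, CStarMatrix.neg_apply, h2, neg_nonneg] at h3
    have h4 := le_antisymm h3 (Finset.sum_nonneg fun i _ => star_mul_self_nonneg _)
    rw [Finset.sum_eq_zero_iff_of_nonneg fun i _ => star_mul_self_nonneg _] at h4
    exact CStarRing.star_mul_self_eq_zero_iff _ |>.mp (h4 k (Finset.mem_univ k))
  have hY0 : Y = 0 := by
    rw [← CStarRing.star_mul_self_eq_zero_iff, hsa]
    conv_lhs => enter [1]; rw [hS]
    rw [mul_assoc, hSY, mul_zero]
  exact hX0 hY0

theorem exists_eq_sum_of_nonneg {X : CStarMatrix n n A} (hX : 0 ≤ X) :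
    ∃ b : n → n → A, ∀ i j, X i j = ∑ k, star (b k i) * b k j := by
  obtain ⟨S, hS⟩ := exists_eq_star_mul_self_of_nonneg hX
  refine ⟨fun k i => S k i, fun i j => ?_⟩
  rw [hS, CStarMatrix.mul_apply]
  simp only [CStarMatrix.star_apply]

variable {H : Type*} [NormedAddCommGroup H] [InnerProductSpace ℂ H] [CompleteSpace H]

open scoped InnerProductSpace ComplexOrder

/-- Testing on the vectors `r i x` reduces the operator-valued form to the scalar one. -/
theorem nonneg_of_forall_sum_inner {X : CStarMatrix n n (H →L[ℂ] H)} (hX : IsSelfAdjoint X)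
    (h : ∀ x : n → H, 0 ≤ ∑ i, ∑ j, ⟪x i, X i j (x j)⟫_ℂ) : 0 ≤ X := by
  refine nonneg_of_forall_sum hX fun r => ?_
  rw [ContinuousLinearMap.nonneg_iff_isPositive, ContinuousLinearMap.isPositive_iff']
  refine ⟨?_, fun x => ?_⟩
  · rw [isSelfAdjoint_iff, star_sum]
    simp only [star_sum, star_mul, star_star]
    rw [Finset.sum_comm]
    refine Finset.sum_congr rfl fun i _ => Finset.sum_congr rfl fun j _ => ?_
    rw [← mul_assoc, ← CStarMatrix.star_apply, hX.star_eq]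
  · rw [← inner_conj_symm, ]
    have := h fun i => r i x
    convert star_nonneg_iff.mpr this using 1
    simp [inner_sum, ContinuousLinearMap.star_eq_adjoint,
      ContinuousLinearMap.adjoint_inner_right]

theorem sum_inner_nonneg {X : CStarMatrix n n (H →L[ℂ] H)} (hX : 0 ≤ X) (x : n → H) :
    0 ≤ ∑ i, ∑ j, ⟪x i, X i j (x j)⟫_ℂ := by
  obtain ⟨b, hb⟩ := exists_eq_sum_of_nonneg hX
  have : ∑ i, ∑ j, ⟪x i, X i j (x j)⟫_ℂ
      = ∑ k, ⟪∑ i, b k i (x i), ∑ j, b k j (x j)⟫_ℂ := by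
    calc _ = ∑ i, ∑ j, ∑ k, ⟪b k i (x i), b k j (x j)⟫_ℂ := by
          simp [hb, ContinuousLinearMap.star_eq_adjoint,
            ContinuousLinearMap.adjoint_inner_right]
      _ = ∑ i, ∑ k, ∑ j, ⟪b k i (x i), b k j (x j)⟫_ℂ :=
          Finset.sum_congr rfl fun i _ => Finset.sum_comm
      _ = _ := by
          rw [Finset.sum_comm]
          refine Finset.sum_congr rfl fun k _ => ?_
          rw [sum_inner]
          simp_rw [inner_sum]
  rw [this]
  refine Finset.sum_nonneg fun k _ => ?_
  rw [inner_self_eq_norm_sq_to_K]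
  exact pow_nonneg (by simp) 2

end CStarMatrix

end

/-! ### Arveson's extension theorem: the cone of formal sums -/

noncomputable section

open scoped InnerProductSpace ComplexOrder ComplexConjugate

section Form

variable {E : Type*} [SeminormedAddCommGroup E] [NormedSpace ℂ E]
variable {H : Type*} [NormedAddCommGroup H] [InnerProductSpace ℂ H] [CompleteSpace H]

/-- A bounded trilinear form (conjugate linear in the last variable) is represented by a linear
map into the bounded operators. -/
theorem exists_linearMap_of_bounded_form (S : E → H → H → ℂ)
    (hb : ∀ b b' ξ η, S (b + b') ξ η = S b ξ η + S b' ξ η)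
    (hb' : ∀ (c : ℂ) b ξ η, S (c • b) ξ η = c * S b ξ η)
    (hξ : ∀ b ξ ξ' η, S b (ξ + ξ') η = S b ξ η + S b ξ' η)
    (hξ' : ∀ (c : ℂ) b ξ η, S b (c • ξ) η = c * S b ξ η)
    (hη : ∀ b ξ η η', S b ξ (η + η') = S b ξ η + S b ξ η')
    (hη' : ∀ (c : ℂ) b ξ η, S b ξ (c • η) = conj c * S b ξ η)
    {C : ℝ} (hC : 0 ≤ C) (hS : ∀ b ξ η, ‖S b ξ η‖ ≤ C * (‖b‖ * ‖ξ‖ * ‖η‖)) :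
    ∃ T : E →ₗ[ℂ] H →L[ℂ] H, (∀ b ξ η, ⟪η, T b ξ⟫_ℂ = S b ξ η) ∧ ∀ b, ‖T b‖ ≤ C * ‖b‖ := by
  have key : ∀ b, ∃ T : H →L[ℂ] H, ∀ ξ η, ⟪η, T ξ⟫_ℂ = S b ξ η := fun b => by
    let L : H →ₗ⋆[ℂ] H →ₗ[ℂ] ℂ := LinearMap.mk₂'ₛₗ (starRingEnd ℂ) (RingHom.id ℂ)
      (fun ξ η => conj (S b ξ η)) (fun _ _ _ => by simp [hξ]) (fun _ _ _ => by simp [hξ'])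
      (fun _ _ _ => by simp [hη]) (fun _ _ _ => by simp [hη'])
    let L' := L.mkContinuous₂ (C * ‖b‖) fun ξ η => by
      simpa [L, mul_assoc] using hS b ξ η
    refine ⟨InnerProductSpace.continuousLinearMapOfBilin L', fun ξ η => ?_⟩
    rw [← inner_conj_symm, InnerProductSpace.continuousLinearMapOfBilin_apply]
    simp [L', L]
  choose T hT using key
  refine ⟨⟨⟨T, fun b b' => ?_⟩, fun c b => ?_⟩, fun b ξ η => hT b ξ η, fun b => ?_⟩
  · ext ξ
    exact ext_inner_left ℂ fun η => by simp [inner_add_right, hT, hb]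
  · ext ξ
    exact ext_inner_left ℂ fun η => by simp [inner_smul_right, hT, hb']
  · refine ContinuousLinearMap.opNorm_le_bound _ (by positivity) fun ξ => ?_
    have h1 := hS b ξ (T b ξ)
    rw [← hT, inner_self_eq_norm_sq_to_K] at h1
    simp only [Complex.coe_algebraMap, norm_pow, Complex.norm_real, norm_norm] at h1
    change ‖T b ξ‖ ≤ _
    rcases (norm_nonneg (T b ξ)).eq_or_lt with h0 | h0
    · rw [← h0]; positivity
    · refine le_of_mul_le_mul_right ?_ h0
      linarith

end Form

namespace ArvesonExtension

section Eval

variable {B : Type*} [CStarAlgebra B]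
variable {H : Type*} [NormedAddCommGroup H] [InnerProductSpace ℂ H]

/-- The value of a formal sum of triples `(b, ξ, η)` under `(b, ξ, η) ↦ (R η)⋆ b (R ξ)`. -/
def eval (R : H →ₗ[ℂ] B) : ((B × H × H) →₀ ℂ) →ₗ[ℂ] B :=
  Finsupp.linearCombination ℂ fun t => star (R t.2.2) * t.1 * R t.2.1

theorem eval_single (R : H →ₗ[ℂ] B) (b : B) (ξ η : H) (c : ℂ) :
    eval R (Finsupp.single (b, ξ, η) c) = c • (star (R η) * b * R ξ) := by
  simp [eval]

end Eval

/-- The formal sums of triples whose values have positive real part. -/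
def cone (B H : Type*) [CStarAlgebra B] [PartialOrder B] [StarOrderedRing B]
    [NormedAddCommGroup H] [InnerProductSpace ℂ H] : PointedCone ℝ ((B × H × H) →₀ ℂ) where
  carrier := {v | ∀ R : H →ₗ[ℂ] B, 0 ≤ eval R v + star (eval R v)}
  zero_mem' := by simp
  add_mem' := fun {v w} hv hw R => by
    have := add_nonneg (hv R) (hw R)
    rw [map_add, star_add]
    convert this using 1
    abel
  smul_mem' := fun c v hv R => by
    have h1 : eval R (c • v) = ((c : ℝ) : ℂ) • eval R v := by
      rw [← map_smul]; congr 1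
    rw [h1, star_smul, Complex.star_def, Complex.conj_ofReal, ← smul_add]
    exact smul_nonneg (by exact_mod_cast c.2) (hv R)

variable {B : Type*} [CStarAlgebra B] [PartialOrder B] [StarOrderedRing B]
variable {H : Type*} [NormedAddCommGroup H] [InnerProductSpace ℂ H]

theorem mem_cone {v : (B × H × H) →₀ ℂ} :
    v ∈ cone B H ↔ ∀ R : H →ₗ[ℂ] B, 0 ≤ eval R v + star (eval R v) := Iff.rfl

/-- The cofinality hypothesis of the M. Riesz extension theorem: triples with first entry `1` absorb
everything. -/
theorem exists_add_mem_cone (y : (B × H × H) →₀ ℂ) :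
    ∃ x ∈ Finsupp.supported ℂ ℂ {t : B × H × H | t.1 = 1}, x + y ∈ cone B H := by
  induction y using Finsupp.induction_linear with
  | zero => exact ⟨0, zero_mem _, by simp⟩
  | add y z hy hz =>
    obtain ⟨x, hx, hxy⟩ := hy
    obtain ⟨x', hx', hxz⟩ := hz
    refine ⟨x + x', add_mem hx hx', ?_⟩
    rw [add_add_add_comm]
    exact add_mem hxy hxz
  | single t c =>
    obtain ⟨b, ξ, η⟩ := t
    let α : ℝ := ‖c • b‖ ^ 2
    refine ⟨Finsupp.single (1, ξ, ξ) ((α / 2 : ℝ) : ℂ) +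
      Finsupp.single (1, η, η) ((1 / 2 : ℝ) : ℂ), add_mem ?_ ?_, fun R => ?_⟩
    · exact Finsupp.single_mem_supported _ _ rfl
    · exact Finsupp.single_mem_supported _ _ rfl
    -- Expanding this square, the cross terms are the value of the given triple plus its adjoint,
    -- and the square of `(c • b) * R ξ` is at most `α • (star (R ξ) * R ξ)`. The weights are halved
    -- because membership in the cone adds the adjoint.
    · have h1 := star_mul_self_nonneg (R η + (c • b) * R ξ)
      have h2 : star (R ξ) * (star (c • b) * (c • b)) * R ξ ≤ α • (star (R ξ) * R ξ) := by
        have := CStarAlgebra.star_left_conjugate_le_norm_smul (a := R ξ)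
          (b := star (c • b) * (c • b)) (IsSelfAdjoint.star_mul_self _)
        rwa [CStarRing.norm_star_mul_self, ← sq] at this
      have h3 : star (R η + (c • b) * R ξ) * (R η + (c • b) * R ξ) =
          star (R η) * R η + star (R ξ) * (star (c • b) * (c • b)) * R ξ +
          (c • (star (R η) * b * R ξ) + star (c • (star (R η) * b * R ξ))) := by
        simp only [star_add, star_mul, add_mul, mul_add, star_smul, smul_mul_assoc,
          mul_smul_comm, star_star, mul_assoc, smul_add]
        abel
      rw [h3] at h1
      have h4 := add_nonneg h1 (sub_nonneg.mpr h2)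
      simp only [map_add, eval_single, star_add, star_smul, Complex.star_def, Complex.conj_ofReal,
        star_mul, star_star, mul_one]
      convert h4 using 1
      simp only [star_smul, star_mul, star_star, Complex.star_def]
      have e1 : ∀ (r : ℝ) (x : B), ((r / 2 : ℝ) : ℂ) • x + ((r / 2 : ℝ) : ℂ) • x = r • x := by
        intro r x
        rw [← add_smul, ← Complex.ofReal_add, add_halves]; rfl
      have e2 := e1 α (star (R ξ) * R ξ)
      have e3 := e1 1 (star (R η) * R η)
      rw [one_smul] at e3
      generalize ((α / 2 : ℝ) : ℂ) • (star (R ξ) * R ξ) = P at e2 ⊢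
      generalize ((1 / 2 : ℝ) : ℂ) • (star (R η) * R η) = Q at e3 ⊢
      rw [← e2, ← e3]
      abel

theorem constr_eq_sum {ι M : Type*} [AddCommGroup M] [Module ℂ M] (β : Module.Basis ι ℂ H)
    (g : ι → M) {ξ : H} {J : Finset ι} (hJ : (β.repr ξ).support ⊆ J) :
    β.constr ℂ g ξ = ∑ j ∈ J, β.repr ξ j • g j := by
  rw [Module.Basis.constr_apply, Finsupp.sum_of_support_subset _ hJ _ (by simp)]

theorem eq_sum_repr {ι : Type*} (β : Module.Basis ι ℂ H) {ξ : H} {J : Finset ι}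
    (hJ : (β.repr ξ).support ⊆ J) : ξ = ∑ j ∈ J, β.repr ξ j • β j := by
  conv_lhs => rw [← β.linearCombination_repr ξ]
  rw [Finsupp.linearCombination_apply, Finsupp.sum_of_support_subset _ hJ _ (by simp)]

variable [CompleteSpace H]
variable {A : Type*} [CStarAlgebra A] [PartialOrder A] [StarOrderedRing A]

/-- Compression of `x` by its negative part `y` gives `-y³`. Its image is both nonnegative and
nonpositive, so injectivity kills `y`. -/
theorem nonneg_of_map_nonneg (ι : A →⋆ₐ[ℂ] B) (hι : Function.Injective ι) {x : A}
    (hx : 0 ≤ ι x) : 0 ≤ x := by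
  have hsa : IsSelfAdjoint x := by
    refine hι ?_
    rw [map_star, (IsSelfAdjoint.of_nonneg hx).star_eq]
  obtain ⟨y, hy, hxy, hx0⟩ := hsa.exists_nonneg_mul_eq_neg_mul_self
  obtain ⟨s, hs⟩ := exists_eq_star_mul_self_of_nonneg hy
  have hsy : star y = y := (IsSelfAdjoint.of_nonneg hy).star_eq
  have h1 : star y * x * y = -(star (s * y) * (s * y)) := by
    rw [mul_assoc, hxy, star_mul, hsy]
    conv_rhs => rw [mul_assoc, ← mul_assoc (star s), ← hs]
    rw [mul_neg]
  have h2 : 0 ≤ star (ι y) * ι x * ι y := star_left_conjugate_nonneg hx _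
  rw [← map_star, ← map_mul, ← map_mul, h1, map_neg, neg_nonneg, map_mul, map_star] at h2
  have h3 := (CStarRing.star_mul_self_eq_zero_iff _).mp
    (le_antisymm h2 (star_mul_self_nonneg (ι (s * y))))
  have h4 : s * y = 0 := hι (by rw [h3, map_zero])
  refine hx0 ?_
  rw [← CStarRing.star_mul_self_eq_zero_iff, hsy]
  nth_rewrite 1 [hs]
  rw [mul_assoc, h4, mul_zero]

/-- Complete positivity of `φ` says that its functional is nonnegative on the cone. Expanding the
vectors in a Hamel basis turns the formal sum into a finite matrix `m` over `A`. Lying in the cone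
means that `X = m + m*` has a positive quadratic form, and `φ` is applied to `X`. -/
theorem re_sum_inner_nonneg {κ : Type*} (s : Finset κ) (c : κ → ℂ) (a : κ → A) (ξ η : κ → H)
    (ι : A →⋆ₐ[ℂ] B) (hι : Function.Injective ι) (φ : A →CP (H →L[ℂ] H))
    (h : ∀ R : H →ₗ[ℂ] B, 0 ≤ (∑ k ∈ s, c k • (star (R (η k)) * ι (a k) * R (ξ k))) +
      star (∑ k ∈ s, c k • (star (R (η k)) * ι (a k) * R (ξ k)))) :
    0 ≤ (∑ k ∈ s, c k * ⟪η k, φ (a k) (ξ k)⟫_ℂ).re := by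
  classical
  let β := Module.Basis.ofVectorSpace ℂ H
  let J : Finset _ := s.biUnion fun k => (β.repr (ξ k)).support ∪ (β.repr (η k)).support
  have hJξ : ∀ k ∈ s, (β.repr (ξ k)).support ⊆ J := fun k hk =>
    Finset.subset_union_left.trans (Finset.subset_biUnion_of_mem (fun k =>
      (β.repr (ξ k)).support ∪ (β.repr (η k)).support) hk)
  have hJη : ∀ k ∈ s, (β.repr (η k)).support ⊆ J := fun k hk =>
    Finset.subset_union_right.trans (Finset.subset_biUnion_of_mem (fun k =>
      (β.repr (ξ k)).support ∪ (β.repr (η k)).support) hk)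
  let m : J → J → A := fun i j =>
    ∑ k ∈ s, (c k * (conj (β.repr (η k) i) * β.repr (ξ k) j)) • a k
  let X : CStarMatrix J J A := CStarMatrix.ofMatrix fun i j => m i j + star (m j i)
  have hXsa : IsSelfAdjoint X := by
    ext i j
    change star (m j i + star (m i j)) = m i j + star (m j i)
    rw [star_add, star_star, add_comm]
  have hX : 0 ≤ X := by
    refine CStarMatrix.nonneg_of_forall_sum hXsa fun r => ?_
    refine nonneg_of_map_nonneg ι hι ?_
    -- `R` need not be bounded, so its values on the Hamel basis can be prescribed.
    let R : H →ₗ[ℂ] B := β.constr ℂ fun i => if hi : i ∈ J then ι (r ⟨i, hi⟩) else 0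
    have hR : ∀ x : H, (β.repr x).support ⊆ J → R x = ∑ j : J, β.repr x j • ι (r j) := by
      intro x hx
      rw [constr_eq_sum β _ hx, ← Finset.sum_coe_sort]
      simp
    have h2 : ι (∑ i : J, ∑ j : J, star (r i) * m i j * r j) =
        ∑ k ∈ s, c k • (star (R (η k)) * ι (a k) * R (ξ k)) := by
      calc _ = ∑ i : J, ∑ j : J, ∑ k ∈ s, (c k * (conj (β.repr (η k) i) * β.repr (ξ k) j)) •
              (star (ι (r i)) * ι (a k) * ι (r j)) := by
            simp only [m, map_sum, map_mul, map_smul, map_star, Finset.mul_sum, Finset.sum_mul,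
              mul_smul_comm, smul_mul_assoc]
        _ = ∑ k ∈ s, ∑ i : J, ∑ j : J, (c k * (conj (β.repr (η k) i) * β.repr (ξ k) j)) •
              (star (ι (r i)) * ι (a k) * ι (r j)) := by
            rw [Finset.sum_comm (s := s)]
            exact Finset.sum_congr rfl fun i _ => Finset.sum_comm
        _ = _ := by
            refine Finset.sum_congr rfl fun k hk => ?_
            rw [hR _ (hJξ k hk), hR _ (hJη k hk)]
            simp only [star_sum, star_smul, Finset.sum_mul, Finset.mul_sum, smul_mul_assoc,
              mul_smul_comm, smul_smul, Finset.smul_sum, Complex.star_def]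
            rw [Finset.sum_comm]
            refine Finset.sum_congr rfl fun i _ => Finset.sum_congr rfl fun j _ => ?_
            congr 1
            ring
    convert h R using 1
    rw [← h2, ← map_star, ← map_add, star_sum]
    congr 1
    simp only [star_sum, star_mul, star_star]
    rw [Finset.sum_comm (f := fun i j : J => star (r j) * (star (m i j) * r i)), ← Finset.sum_add_distrib]
    refine Finset.sum_congr rfl fun i _ => ?_
    rw [← Finset.sum_add_distrib]
    refine Finset.sum_congr rfl fun j _ => ?_
    change star (r i) * (m i j + star (m j i)) * r j = _
    rw [mul_add, add_mul, mul_assoc _ (star (m j i))]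
  have h3 := CStarMatrix.sum_inner_nonneg (φ.map_cstarMatrix_nonneg X hX) fun i : J => β i
  have h4 : ∑ i : J, ∑ j : J, ⟪β i, φ (m i j) (β j)⟫_ℂ = ∑ k ∈ s, c k * ⟪η k, φ (a k) (ξ k)⟫_ℂ := by
    calc _ = ∑ i : J, ∑ j : J, ∑ k ∈ s, c k * (conj (β.repr (η k) i) * (β.repr (ξ k) j *
            ⟪β i, φ (a k) (β j)⟫_ℂ)) := by
          refine Finset.sum_congr rfl fun i _ => Finset.sum_congr rfl fun j _ => ?_
          simp only [m, map_sum, map_smul, sum_apply, inner_sum, FunLike.coe_smul, Pi.smul_apply,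
            inner_smul_right]
          exact Finset.sum_congr rfl fun k _ => by ring
      _ = ∑ k ∈ s, ∑ i : J, ∑ j : J, c k * (conj (β.repr (η k) i) * (β.repr (ξ k) j *
            ⟪β i, φ (a k) (β j)⟫_ℂ)) := by
          rw [Finset.sum_comm (s := s)]
          exact Finset.sum_congr rfl fun i _ => Finset.sum_comm
      _ = _ := by
          refine Finset.sum_congr rfl fun k hk => ?_
          conv_rhs => rw [eq_sum_repr β (hJξ k hk), eq_sum_repr β (hJη k hk)]
          simp only [map_sum, map_smul, inner_sum, sum_inner, inner_smul_left, inner_smul_right,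
            Finset.mul_sum, ← Finset.sum_coe_sort J]
          rw [Finset.sum_comm]
          exact Finset.sum_congr rfl fun i _ => Finset.sum_congr rfl fun j _ => by ring
  have h5 : ∑ i : J, ∑ j : J, ⟪β i, φ (X i j) (β j)⟫_ℂ =
      (∑ k ∈ s, c k * ⟪η k, φ (a k) (ξ k)⟫_ℂ) +
        conj (∑ k ∈ s, c k * ⟪η k, φ (a k) (ξ k)⟫_ℂ) := by
    rw [← h4, map_sum]
    simp only [map_sum, inner_conj_symm]
    rw [Finset.sum_comm (f := fun i j : J => ⟪φ (m i j) (β j), β i⟫_ℂ), ← Finset.sum_add_distrib]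
    refine Finset.sum_congr rfl fun i _ => ?_
    rw [← Finset.sum_add_distrib]
    refine Finset.sum_congr rfl fun j _ => ?_
    change ⟪β i, φ (m i j + star (m j i)) (β j)⟫_ℂ = _
    rw [map_add, map_star, add_apply, inner_add_right, ContinuousLinearMap.star_eq_adjoint,
      ContinuousLinearMap.adjoint_inner_right]
  simp only [CStarMatrix.map_apply] at h3
  rw [h5, Complex.add_conj] at h3
  have h6 : 0 ≤ 2 * (∑ k ∈ s, c k * ⟪η k, φ (a k) (ξ k)⟫_ℂ).re := by exact_mod_cast h3
  linarith

end ArvesonExtension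

end

/-! ### Arveson's extension theorem: the extension and its norm -/

noncomputable section

open scoped InnerProductSpace ComplexOrder ComplexConjugate

namespace ArvesonExtension

variable {B : Type*} [CStarAlgebra B] [PartialOrder B] [StarOrderedRing B]
variable {H : Type*} [NormedAddCommGroup H] [InnerProductSpace ℂ H] [CompleteSpace H]
variable {A : Type*} [CStarAlgebra A] [PartialOrder A] [StarOrderedRing A]

/-- The M. Riesz theorem extends the real part of the functional of `φ` from the triples over
`ι(A)`, keeping it nonnegative on the cone; `F` is the complexification of the result. -/
theorem exists_functional (ι : A →⋆ₐ[ℂ] B) (hι : Function.Injective ι) (φ : A →CP (H →L[ℂ] H)) :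
    ∃ F : ((B × H × H) →₀ ℂ) →ₗ[ℂ] ℂ,
      (∀ a ξ η, F (Finsupp.single (ι a, ξ, η) 1) = ⟪η, φ a ξ⟫_ℂ) ∧
      (∀ v, (∀ R, 0 ≤ eval R v) → 0 ≤ F v) ∧
      (∀ v w, (∀ R, eval R w = star (eval R v)) → F w = conj (F v)) := by
  -- Outside the range of `ι`, `Function.invFun` takes a default value; only the values on `D`
  -- matter.
  let Φ : ((B × H × H) →₀ ℂ) →ₗ[ℂ] ℂ :=
    Finsupp.linearCombination ℂ fun t => ⟪t.2.2, φ (Function.invFun ι t.1) t.2.1⟫_ℂ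
  let D : Submodule ℝ ((B × H × H) →₀ ℂ) :=
    (Finsupp.supported ℂ ℂ {t : B × H × H | t.1 ∈ Set.range ι}).restrictScalars ℝ
  let f : ((B × H × H) →₀ ℂ) →ₗ[ℝ] ℝ := Complex.reLm ∘ₗ Φ.restrictScalars ℝ
  have hf : ∀ v ∈ D, v ∈ cone B H → 0 ≤ f v := by
    intro v hvD hv
    have := re_sum_inner_nonneg v.support v (fun t => Function.invFun ι t.1)
      (fun t => t.2.1) (fun t => t.2.2) ι hι φ fun R => by
        convert mem_cone.mp hv R using 1
        have : ∑ t ∈ v.support,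
            v t • (star (R t.2.2) * ι (Function.invFun ι t.1) * R t.2.1) = eval R v := by
          rw [eval, Finsupp.linearCombination_apply, Finsupp.sum]
          refine Finset.sum_congr rfl fun t ht => ?_
          rw [Function.invFun_eq ((Finsupp.mem_supported _ _).mp hvD ht)]
        rw [this]
    simpa [f, Φ, Finsupp.linearCombination_apply, Finsupp.sum] using this
  obtain ⟨g, hgD, hgs⟩ := riesz_extension (cone B H) ⟨D, f.domRestrict D⟩
    (fun x hx => hf x x.2 hx) (fun y => by
      obtain ⟨x, hx, hxy⟩ := exists_add_mem_cone y
      refine ⟨⟨x, ?_⟩, hxy⟩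
      refine Finsupp.supported_mono ?_ hx
      rintro t (ht : t.1 = 1)
      exact ⟨1, by rw [map_one, ht]⟩)
  -- Here both `v` and `-v` lie in the cone. This makes `F` depend only on the values `eval R v`.
  have hg0 : ∀ v, (∀ R, eval R v + star (eval R v) = 0) → g v = 0 := by
    intro v hv
    refine le_antisymm ?_ (hgs v fun R => (hv R).ge)
    have := hgs (-v) fun R => by
      rw [map_neg, star_neg, ← neg_add, hv R, neg_zero]
    rw [map_neg] at this
    linarith
  let F : ((B × H × H) →₀ ℂ) →ₗ[ℂ] ℂ :=
    Module.Dual.extendRCLike (𝕜 := ℂ) (g : Module.Dual ℝ _)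
  have hF : ∀ v, F v = (g v : ℂ) - Complex.I * (g (Complex.I • v) : ℂ) := fun v =>
    Module.Dual.extendRCLike_apply _ _
  refine ⟨F, fun a ξ η => ?_, fun v hv => ?_, fun v w hvw => ?_⟩
  · have h1 : ∀ c : ℂ, g (Finsupp.single (ι a, ξ, η) c) = (c * ⟪η, φ a ξ⟫_ℂ).re := by
      intro c
      have := hgD ⟨Finsupp.single (ι a, ξ, η) c, Finsupp.single_mem_supported _ _ ⟨a, rfl⟩⟩
      refine this.trans ?_
      simp [f, Φ, Function.leftInverse_invFun hι a]
    rw [hF, Finsupp.smul_single, h1, h1]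
    apply Complex.ext <;> simp
  · have h1 : g (Complex.I • v) = 0 := hg0 _ fun R => by
      rw [map_smul, star_smul, (IsSelfAdjoint.of_nonneg (hv R)).star_eq, ← add_smul]
      simp
    rw [hF, h1]
    have h2 := hgs v fun R => by
      rw [(IsSelfAdjoint.of_nonneg (hv R)).star_eq]
      exact add_nonneg (hv R) (hv R)
    simpa using h2
  · have h1 : g (w - v) = 0 := hg0 _ fun R => by
      rw [map_sub, hvw, star_sub, star_star]; abel
    have h2 : g (Complex.I • (w + v)) = 0 := hg0 _ fun R => by
      rw [map_smul, map_add, hvw, star_smul, star_add, star_star, add_comm (eval R v),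
        ← add_smul]
      simp
    rw [map_sub, sub_eq_zero] at h1
    rw [smul_add, map_add] at h2
    rw [hF, hF, h1, eq_neg_of_add_eq_zero_left h2]
    simp

end ArvesonExtension

open ArvesonExtension

variable {B : Type*} [CStarAlgebra B] [PartialOrder B] [StarOrderedRing B]
variable {H : Type*} [NormedAddCommGroup H] [InnerProductSpace ℂ H] [CompleteSpace H]
variable {A : Type*} [CStarAlgebra A] [PartialOrder A] [StarOrderedRing A]

/-- **Arveson's extension theorem**. -/
theorem CompletelyPositiveMap.exists_extension (ι : A →⋆ₐ[ℂ] B) (hι : Function.Injective ι)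
    (φ : A →CP (H →L[ℂ] H)) :
    ∃ ψ : B →CP (H →L[ℂ] H), (∀ a, ψ (ι a) = φ a) ∧ ∀ b, ‖ψ b‖ ≤ ‖φ 1‖ * ‖b‖ := by
  obtain ⟨F, hFφ, hFpos, hFstar⟩ := exists_functional ι hι φ
  let S : B → H → H → ℂ := fun b ξ η => F (Finsupp.single (b, ξ, η) 1)
  have hF0 : ∀ v, (∀ R, eval R v = 0) → F v = 0 := fun v hv =>
    le_antisymm (by
      have := hFpos (-v) fun R => by rw [map_neg, hv, neg_zero]
      rwa [map_neg, neg_nonneg] at this) (hFpos v fun R => (hv R).ge)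
  have hFeq : ∀ v w, (∀ R, eval R v = eval R w) → F v = F w := fun v w h => by
    rw [← sub_eq_zero, ← map_sub]
    exact hF0 _ fun R => by rw [map_sub, h, sub_self]
  have hS1 : ∀ ξ η, S 1 ξ η = ⟪η, φ 1 ξ⟫_ℂ := fun ξ η => by
    rw [← hFφ 1 ξ η, map_one]
  have hSstar : ∀ b ξ η, S (star b) η ξ = conj (S b ξ η) := fun b ξ η =>
    hFstar _ _ fun R => by simp [eval_single, mul_assoc]
  have hS1le : ∀ ξ, (S 1 ξ ξ).re ≤ ‖φ 1‖ * ‖ξ‖ ^ 2 := fun ξ => by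
    rw [hS1]
    calc (⟪ξ, φ 1 ξ⟫_ℂ).re ≤ ‖⟪ξ, φ 1 ξ⟫_ℂ‖ := Complex.re_le_norm _
      _ ≤ ‖ξ‖ * ‖φ 1 ξ‖ := norm_inner_le_norm _ _
      _ ≤ ‖ξ‖ * (‖φ 1‖ * ‖ξ‖) := by gcongr; exact (φ 1).le_opNorm ξ
      _ = _ := by ring
  have hSle : ∀ b ξ, (S (star b * b) ξ ξ).re ≤ ‖b‖ ^ 2 * (‖φ 1‖ * ‖ξ‖ ^ 2) := by
    intro b ξ
    have h1 : 0 ≤ F (Finsupp.single (1, ξ, ξ) ((‖b‖ ^ 2 : ℝ) : ℂ) -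
        Finsupp.single (star b * b, ξ, ξ) 1) := hFpos _ fun R => by
      rw [map_sub, eval_single, eval_single, one_smul, mul_one, sub_nonneg]
      have := CStarAlgebra.star_left_conjugate_le_norm_smul (a := R ξ)
        (b := star b * b) (IsSelfAdjoint.star_mul_self _)
      rwa [CStarRing.norm_star_mul_self, ← sq] at this
    have h2 : F (Finsupp.single (1, ξ, ξ) ((‖b‖ ^ 2 : ℝ) : ℂ)) =
        ((‖b‖ ^ 2 : ℝ) : ℂ) * ⟪ξ, φ 1 ξ⟫_ℂ := by
      rw [← hS1, ← smul_eq_mul, ← map_smul, Finsupp.smul_single, smul_eq_mul, mul_one]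
    rw [map_sub, h2, sub_nonneg] at h1
    have h3 := (Complex.le_def.mp h1).1
    rw [Complex.re_ofReal_mul] at h3
    rw [← hS1] at h3
    exact h3.trans (mul_le_mul_of_nonneg_left (hS1le ξ) (by positivity))
  have hSbound : ∀ b ξ η, ‖S b ξ η‖ ≤ ‖φ 1‖ * (‖b‖ * ‖ξ‖ * ‖η‖) := by
    intro b ξ η
    obtain ⟨u, hu, huS⟩ : ∃ u : ℂ, ‖u‖ = 1 ∧ u * S b ξ η = (‖S b ξ η‖ : ℂ) := by
      obtain ⟨u, hu, huS⟩ := RCLike.exists_norm_eq_mul_self (S b ξ η)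
      exact ⟨u, hu, huS.symm⟩
    -- Cauchy–Schwarz for `S`: `F` is nonnegative on the formal sum representing the square of `b *
    -- R ξ - c • R η`. With `c = t * conj u` the phase `u` makes the cross terms real, and the
    -- discriminant of the quadratic in `t` gives the bound.
    have hq : ∀ t : ℝ, 0 ≤ (‖φ 1‖ * ‖η‖ ^ 2) * (t * t) + (-2 * ‖S b ξ η‖) * t +
        ‖b‖ ^ 2 * (‖φ 1‖ * ‖ξ‖ ^ 2) := by
      intro t
      obtain ⟨c, hc⟩ : ∃ c : ℂ, c = t * conj u := ⟨_, rfl⟩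
      have hcc : conj c = t * u := by simp [hc]
      have h1 := hFpos (Finsupp.single (star b * b, ξ, ξ) 1 +
        Finsupp.single (b, ξ, η) (-(conj c)) + Finsupp.single (star b, η, ξ) (-c) +
        Finsupp.single (1, η, η) ((t * t : ℝ) : ℂ)) fun R => by
          have := star_mul_self_nonneg (b * R ξ - c • R η)
          convert this using 1
          simp only [map_add, eval_single]
          simp only [star_sub, star_mul, star_smul, sub_mul, mul_sub, smul_mul_assoc,
            mul_smul_comm, smul_sub, smul_smul, one_smul, mul_one, neg_smul, mul_assoc,
            Complex.star_def]
          have : c * conj c = ((t * t : ℝ) : ℂ) := by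
            have : u * conj u = 1 := by rw [Complex.mul_conj, Complex.normSq_eq_norm_sq, hu]; simp
            rw [hcc, hc]
            push_cast
            linear_combination (t * t : ℂ) * this
          rw [this]
          abel
      have hsm : ∀ b ξ η c, F (Finsupp.single (b, ξ, η) c) = c * S b ξ η := by
        intro b ξ η c
        rw [← smul_eq_mul, ← map_smul, Finsupp.smul_single, smul_eq_mul, mul_one]
      simp only [map_add, hsm, one_mul, hSstar, hcc] at h1
      rw [hc] at h1
      have h2 := (Complex.le_def.mp h1).1
      have h3 : (-(t * conj u) * conj (S b ξ η)).re = -(t * ‖S b ξ η‖) := by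
        rw [neg_mul, mul_assoc, ← map_mul, huS, Complex.conj_ofReal, Complex.neg_re,
          Complex.re_ofReal_mul, Complex.ofReal_re]
      have h4 : (-(t * u) * S b ξ η).re = -(t * ‖S b ξ η‖) := by
        rw [neg_mul, mul_assoc, huS, Complex.neg_re, Complex.re_ofReal_mul, Complex.ofReal_re]
      have h5 := mul_le_mul_of_nonneg_left (hS1le η) (mul_self_nonneg t)
      have h6 := hSle b ξ
      rw [Complex.add_re, Complex.add_re, Complex.add_re, h3, h4, Complex.re_ofReal_mul,
        Complex.zero_re] at h2
      linarith
    have h1 := discrim_le_zero hq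
    rw [discrim] at h1
    refine abs_le_of_sq_le_sq' ?_ (by positivity) |>.2
    nlinarith
  obtain ⟨T, hT, hTn⟩ := exists_linearMap_of_bounded_form S
    (fun b b' ξ η => by
      rw [← map_add]
      exact hFeq _ _ fun R => by simp [eval_single, add_mul, mul_add])
    (fun c b ξ η => by
      rw [← smul_eq_mul, ← map_smul]
      exact hFeq _ _ fun R => by simp [eval_single])
    (fun b ξ ξ' η => by
      rw [← map_add]
      exact hFeq _ _ fun R => by simp [eval_single, mul_add])
    (fun c b ξ η => by
      rw [← smul_eq_mul, ← map_smul]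
      exact hFeq _ _ fun R => by simp [eval_single])
    (fun b ξ η η' => by
      rw [← map_add]
      exact hFeq _ _ fun R => by simp [eval_single, add_mul])
    (fun c b ξ η => by
      rw [← smul_eq_mul, ← map_smul]
      exact hFeq _ _ fun R => by simp [eval_single])
    (norm_nonneg (φ 1)) hSbound
  have hTstar : ∀ b, T (star b) = star (T b) := by
    intro b
    ext η
    refine ext_inner_left ℂ fun ξ => ?_
    rw [hT, hSstar, ← hT, inner_conj_symm, ContinuousLinearMap.star_eq_adjoint,
      ContinuousLinearMap.adjoint_inner_right]
  refine ⟨⟨T, fun k X hX => ?_⟩, fun a => ?_, hTn⟩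
  · refine CStarMatrix.nonneg_of_forall_sum_inner ?_ fun x => ?_
    · ext1 i j
      rw [CStarMatrix.star_apply, CStarMatrix.map_apply, CStarMatrix.map_apply, ← hTstar,
        ← CStarMatrix.star_apply, (IsSelfAdjoint.of_nonneg hX).star_eq]
    · obtain ⟨b, hb⟩ := CStarMatrix.exists_eq_sum_of_nonneg hX
      have h1 := hFpos (∑ i, ∑ j, Finsupp.single (X i j, x j, x i) 1) fun R => by
        have : eval R (∑ i, ∑ j, Finsupp.single (X i j, x j, x i) 1) =
            ∑ m, star (∑ i, b m i * R (x i)) * ∑ i, b m i * R (x i) := by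
          calc _ = ∑ i, ∑ j, ∑ m, star (b m i * R (x i)) * (b m j * R (x j)) := by
                simp only [map_sum, eval_single, one_smul, hb, star_mul, Finset.sum_mul,
                  Finset.mul_sum, mul_assoc]
            _ = ∑ m, ∑ i, ∑ j, star (b m i * R (x i)) * (b m j * R (x j)) :=
                (Finset.sum_congr rfl fun i _ => Finset.sum_comm).trans Finset.sum_comm
            _ = _ := by simp only [star_sum, Finset.sum_mul_sum]
        rw [this]
        exact Finset.sum_nonneg fun m _ => star_mul_self_nonneg _
      simp only [map_sum] at h1
      convert h1 using 4 with i _ j _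
      exact hT _ _ _
  · change T (ι a) = φ a
    ext ξ
    refine ext_inner_left ℂ fun η => ?_
    rw [hT]
    exact hFφ a ξ η

end

/-! ### Tomiyama's theorem: positivity and the module property -/

noncomputable section

open scoped InnerProductSpace ComplexOrder ComplexConjugate

variable {H : Type*} [NormedAddCommGroup H] [InnerProductSpace ℂ H] [CompleteSpace H]

namespace ContinuousLinearMap

/-- A contractive unital linear map between operator algebras is self-adjoint. -/
theorem im_inner_eq_zero_of_contractive {E : (H →L[ℂ] H) →ₗ[ℂ] (H →L[ℂ] H)}
    (hE : ∀ x, ‖E x‖ ≤ ‖x‖) (hE1 : E 1 = 1) {a : H →L[ℂ] H} (ha : IsSelfAdjoint a) (ξ : H) :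
    (⟪ξ, E a ξ⟫_ℂ).im = 0 := by
  rcases eq_or_ne ξ 0 with rfl | hξ
  · simp
  have hξ0 : 0 < ‖ξ‖ ^ 2 := by positivity
  set z := ⟪ξ, E a ξ⟫_ℂ
  -- Adding `i t` to `a` raises the squared norm by at most `t²`, while it shifts the imaginary part
  -- of the vector functional by `t ‖ξ‖²`. The terms in `t²` cancel, and a bounded linear function
  -- of `t` has zero slope.
  have key : ∀ t : ℝ, 2 * t * ‖ξ‖ ^ 2 * z.im ≤ ‖a‖ ^ 2 * (‖ξ‖ ^ 2) ^ 2 := by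
    intro t
    have h1 : ‖a + (t * Complex.I : ℂ) • (1 : H →L[ℂ] H)‖ ^ 2 ≤ ‖a‖ ^ 2 + t ^ 2 := by
      rw [sq, ← CStarRing.norm_star_mul_self]
      have : star (a + (t * Complex.I : ℂ) • (1 : H →L[ℂ] H)) *
          (a + (t * Complex.I : ℂ) • (1 : H →L[ℂ] H)) = a * a + ((t ^ 2 : ℝ) : ℂ) • 1 := by
        rw [star_add, star_smul, star_one, ha.star_eq]
        simp only [add_mul, mul_add, mul_smul_comm, smul_mul_assoc, mul_one, one_mul, smul_smul,
          smul_add]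
        have : (t * Complex.I : ℂ) * star (t * Complex.I : ℂ) = ((t ^ 2 : ℝ) : ℂ) := by
          simp only [Complex.star_def, map_mul, Complex.conj_ofReal, Complex.conj_I]
          push_cast
          linear_combination (-(t : ℂ) ^ 2) * Complex.I_sq
        rw [this]
        simp only [Complex.star_def, map_mul, Complex.conj_ofReal, Complex.conj_I, mul_neg,
          neg_smul]
        abel
      rw [this]
      refine (norm_add_le _ _).trans (add_le_add ?_ ?_)
      · exact (norm_mul_le _ _).trans (sq _).ge
      · rw [norm_smul, Complex.norm_real, Real.norm_of_nonneg (sq_nonneg t)]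
        exact mul_le_of_le_one_right (sq_nonneg t) ContinuousLinearMap.norm_id_le
    have h2 : ⟪ξ, E (a + (t * Complex.I : ℂ) • 1) ξ⟫_ℂ = z + (t * ‖ξ‖ ^ 2 : ℝ) * Complex.I := by
      rw [map_add, map_smul, hE1, add_apply, inner_add_right]
      simp only [smul_apply, one_apply_eq_self, inner_smul_right, inner_self_eq_norm_sq_to_K]
      push_cast
      simp only [Complex.coe_algebraMap]
      ring
    have h3 : ‖z + (t * ‖ξ‖ ^ 2 : ℝ) * Complex.I‖ ≤
        ‖a + (t * Complex.I : ℂ) • (1 : H →L[ℂ] H)‖ * ‖ξ‖ ^ 2 := by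
      rw [← h2]
      calc _ ≤ ‖ξ‖ * ‖E (a + (t * Complex.I : ℂ) • 1) ξ‖ := norm_inner_le_norm _ _
        _ ≤ ‖ξ‖ * (‖a + (t * Complex.I : ℂ) • (1 : H →L[ℂ] H)‖ * ‖ξ‖) := by
          gcongr
          exact (ContinuousLinearMap.le_opNorm _ _).trans (by gcongr; exact hE _)
        _ = _ := by ring
    have h4 : (z.im + t * ‖ξ‖ ^ 2) ^ 2 ≤ (‖a‖ ^ 2 + t ^ 2) * (‖ξ‖ ^ 2) ^ 2 := by
      calc (z.im + t * ‖ξ‖ ^ 2) ^ 2 ≤ ‖z + (t * ‖ξ‖ ^ 2 : ℝ) * Complex.I‖ ^ 2 := by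
            have : (z + (t * ‖ξ‖ ^ 2 : ℝ) * Complex.I).im = z.im + t * ‖ξ‖ ^ 2 := by
              rw [Complex.add_im, Complex.im_ofReal_mul, Complex.I_im, mul_one]
            rw [← this, ← sq_abs]
            gcongr
            exact Complex.abs_im_le_norm _
        _ ≤ (‖a + (t * Complex.I : ℂ) • (1 : H →L[ℂ] H)‖ * ‖ξ‖ ^ 2) ^ 2 := by gcongr
        _ ≤ _ := by
          rw [mul_pow]
          gcongr
    nlinarith [sq_nonneg z.im]
  by_contra hz
  have h := key ((‖a‖ ^ 2 * (‖ξ‖ ^ 2) ^ 2 + 1) / (2 * ‖ξ‖ ^ 2 * z.im))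
  have h2 : 2 * ((‖a‖ ^ 2 * (‖ξ‖ ^ 2) ^ 2 + 1) / (2 * ‖ξ‖ ^ 2 * z.im)) * ‖ξ‖ ^ 2 * z.im =
      ‖a‖ ^ 2 * (‖ξ‖ ^ 2) ^ 2 + 1 := by
    field_simp
  linarith

/-- For `a ≥ 0` the element `‖a‖ • 1 - a` has norm at most `‖a‖`. So has its image `‖a‖ • 1 - E a`,
and the real number `⟪ξ, E a ξ⟫` cannot be negative. -/
theorem map_nonneg_of_contractive {E : (H →L[ℂ] H) →ₗ[ℂ] (H →L[ℂ] H)}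
    (hE : ∀ x, ‖E x‖ ≤ ‖x‖) (hE1 : E 1 = 1) {a : H →L[ℂ] H} (ha : 0 ≤ a) : 0 ≤ E a := by
  have him := fun ξ => im_inner_eq_zero_of_contractive hE hE1 (IsSelfAdjoint.of_nonneg ha) ξ
  rw [nonneg_iff_isPositive, isPositive_iff_complex]
  have h1 : ‖((‖a‖ : ℝ) : ℂ) • (1 : H →L[ℂ] H) - a‖ ≤ ‖a‖ := by
    have h2 : a ≤ ((‖a‖ : ℝ) : ℂ) • (1 : H →L[ℂ] H) := by
      have := (CStarAlgebra.norm_le_iff_le_algebraMap a (norm_nonneg a) ha).mp le_rfl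
      rwa [Algebra.algebraMap_eq_smul_one] at this
    refine (CStarAlgebra.norm_le_norm_of_nonneg_of_le (sub_nonneg.mpr h2)
      (sub_le_self _ ha)).trans ?_
    rw [norm_smul, Complex.norm_real, norm_norm]
    exact mul_le_of_le_one_right (norm_nonneg a) norm_id_le
  intro ξ
  have h3 : ‖⟪ξ, E (((‖a‖ : ℝ) : ℂ) • (1 : H →L[ℂ] H) - a) ξ⟫_ℂ‖ ≤ ‖a‖ * ‖ξ‖ ^ 2 := by
    calc _ ≤ ‖ξ‖ * ‖E (((‖a‖ : ℝ) : ℂ) • (1 : H →L[ℂ] H) - a) ξ‖ := norm_inner_le_norm _ _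
      _ ≤ ‖ξ‖ * (‖a‖ * ‖ξ‖) := by
          gcongr
          exact (ContinuousLinearMap.le_opNorm _ _).trans (by gcongr; exact (hE _).trans h1)
      _ = _ := by ring
  have h4 : ⟪ξ, E (((‖a‖ : ℝ) : ℂ) • (1 : H →L[ℂ] H) - a) ξ⟫_ℂ =
      ((‖a‖ * ‖ξ‖ ^ 2 : ℝ) : ℂ) - ⟪ξ, E a ξ⟫_ℂ := by
    rw [map_sub, map_smul, hE1, sub_apply, inner_sub_right]
    simp
  have h5 := (Complex.re_le_norm _).trans h3
  rw [h4, Complex.sub_re, Complex.ofReal_re] at h5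
  have h6 : ⟪E a ξ, ξ⟫_ℂ = ((⟪ξ, E a ξ⟫_ℂ).re : ℂ) := by
    have : ⟪E a ξ, ξ⟫_ℂ = conj ⟪ξ, E a ξ⟫_ℂ := (inner_conj_symm _ _).symm
    rw [this]
    apply Complex.ext
    · rw [Complex.conj_re, Complex.ofReal_re]
    · rw [Complex.conj_im, him, neg_zero, Complex.ofReal_im]
  rw [h6, RCLike.re_to_complex, Complex.ofReal_re]
  exact ⟨rfl, by linarith⟩

/-- **Tomiyama's theorem** for projections. -/
theorem mul_map_of_isStarProjection {E : (H →L[ℂ] H) →ₗ[ℂ] (H →L[ℂ] H)}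
    (hE : ∀ x, ‖E x‖ ≤ ‖x‖) {M : Set (H →L[ℂ] H)} (hEM : ∀ x, E x ∈ M) (hEid : ∀ x ∈ M, E x = x)
    (hM : ∀ x ∈ M, ∀ y ∈ M, x * y ∈ M) {p : H →L[ℂ] H} (hp : IsStarProjection p) (hpM : p ∈ M)
    (hpM' : 1 - p ∈ M) (x : H →L[ℂ] H) : E (p * x) = p * E x := by
  have key : ∀ q : H →L[ℂ] H, IsStarProjection q → q ∈ M → q * E ((1 - q) * x) = 0 := by
    intro q hq hqM
    set y := q * E ((1 - q) * x) with hy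
    set z := (1 - q) * x with hz
    have hyM : y ∈ M := hM _ hqM _ (hEM _)
    have hqy : q * y = y := by rw [hy, ← mul_assoc, hq.isIdempotentElem.eq]
    have hzy : star z * y = 0 := by
      rw [hz, star_mul, star_sub, star_one, hq.isSelfAdjoint.star_eq, ← hqy, ← mul_assoc,
        mul_assoc (star x), sub_mul, one_mul, hq.isIdempotentElem.eq, sub_self, mul_zero, zero_mul]
    have hyz : star y * z = 0 := by
      have := congrArg star hzy
      rwa [star_mul, star_star, star_zero] at this
    -- `z` and `y` have orthogonal ranges, which bounds `‖z + t y‖` above; `q E (z + t y) = (1 + t)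
    -- y` bounds it below. For large `t` this forces `y = 0`.
    have hn : ∀ t : ℝ, 0 ≤ t → (1 + t) ^ 2 * ‖y‖ ^ 2 ≤ ‖z‖ ^ 2 + t ^ 2 * ‖y‖ ^ 2 := by
      intro t ht
      have h1 : ‖z + (t : ℂ) • y‖ ^ 2 ≤ ‖z‖ ^ 2 + t ^ 2 * ‖y‖ ^ 2 := by
        rw [sq, ← CStarRing.norm_star_mul_self]
        have : star (z + (t : ℂ) • y) * (z + (t : ℂ) • y) =
            star z * z + ((t : ℂ) * t) • (star y * y) := by
          simp only [star_add, star_smul, add_mul, mul_add, smul_mul_assoc, mul_smul_comm, hzy, hyz,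
            smul_zero, add_zero, zero_add, smul_smul, Complex.star_def, Complex.conj_ofReal]
        rw [this]
        refine (norm_add_le _ _).trans (le_of_eq ?_)
        rw [CStarRing.norm_star_mul_self, norm_smul, CStarRing.norm_star_mul_self, norm_mul (t : ℂ) t,
          Complex.norm_real, Real.norm_of_nonneg ht]
        ring
      have h2 : q * E (z + (t : ℂ) • y) = ((1 + t : ℝ) : ℂ) • y := by
        rw [map_add, map_smul, hEid y hyM, mul_add, mul_smul_comm, hqy, ← hy]
        push_cast
        rw [add_smul, one_smul]
      have h3 : (1 + t) * ‖y‖ ≤ ‖z + (t : ℂ) • y‖ := by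
        calc (1 + t) * ‖y‖ = ‖q * E (z + (t : ℂ) • y)‖ := by
              rw [h2, norm_smul, Complex.norm_real, Real.norm_of_nonneg (by linarith)]
          _ ≤ ‖q‖ * ‖E (z + (t : ℂ) • y)‖ := norm_mul_le _ _
          _ ≤ 1 * ‖z + (t : ℂ) • y‖ := by
              gcongr
              · exact hq.norm_le
              · exact hE _
          _ = _ := one_mul _
      calc (1 + t) ^ 2 * ‖y‖ ^ 2 = ((1 + t) * ‖y‖) ^ 2 := by ring
        _ ≤ ‖z + (t : ℂ) • y‖ ^ 2 := by gcongr
        _ ≤ _ := h1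
    by_contra hy0
    have hypos : 0 < ‖y‖ ^ 2 := by have := norm_pos_iff.mpr hy0; positivity
    have h := hn (‖z‖ ^ 2 / ‖y‖ ^ 2) (by positivity)
    have h2 : ‖z‖ ^ 2 / ‖y‖ ^ 2 * ‖y‖ ^ 2 = ‖z‖ ^ 2 := div_mul_cancel₀ _ hypos.ne'
    nlinarith [sq_nonneg ‖z‖]
  have h1 := key p hp hpM
  have h2 := key (1 - p) hp.one_sub hpM'
  rw [sub_sub_cancel, sub_mul, one_mul, sub_eq_zero] at h2
  rw [sub_mul, one_mul, map_sub, mul_sub, sub_eq_zero] at h1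
  exact h2.trans h1.symm

end ContinuousLinearMap

namespace VonNeumannAlgebra

theorem commute_of_mem_commutant {M : VonNeumannAlgebra H} {a u : H →L[ℂ] H} (ha : a ∈ M)
    (hu : u ∈ M.commutant) : Commute a u :=
  mem_commutant_iff.mp hu a ha

theorem mem_of_forall_commute {M : VonNeumannAlgebra H} {a : H →L[ℂ] H}
    (h : ∀ u ∈ M.commutant, Commute u a) : a ∈ M := by
  rw [← commutant_commutant M, mem_commutant_iff]
  exact h

/-- A positive contraction `a` in a von Neumann algebra dominates half of a spectral projection
`p` with `2a - p` again a positive contraction. -/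
theorem exists_isStarProjection {M : VonNeumannAlgebra H} {a : H →L[ℂ] H} (haM : a ∈ M)
    (ha : 0 ≤ a) (ha1 : a ≤ 1) :
    ∃ p ∈ M, IsStarProjection p ∧ 0 ≤ a + a - p ∧ a + a - p ≤ 1 := by
  set b := a + a - 1 with hb
  have hbM : b ∈ M := sub_mem (add_mem haM haM) (one_mem M)
  have hbsa : IsSelfAdjoint b :=
    ((IsSelfAdjoint.of_nonneg ha).add (IsSelfAdjoint.of_nonneg ha)).sub (IsSelfAdjoint.one _)
  set c := b⁺ with hc
  set d := b⁻ with hd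
  have hc0 : 0 ≤ c := CFC.posPart_nonneg b
  have hd0 : 0 ≤ d := CFC.negPart_nonneg b
  have hbcd : b = c - d := (CFC.posPart_sub_negPart b hbsa).symm
  have hcd : c * d = 0 := CFC.posPart_mul_negPart b
  have hcM : c ∈ M := mem_of_forall_commute fun u hu => by
    rw [hc, CFC.posPart_def]
    exact (Commute.cfcₙ_real (commute_of_mem_commutant hbM hu) _).symm
  let K : Submodule ℂ H := c.ker
  have hKc : IsClosed (K : Set H) := c.isClosed_ker
  have : CompleteSpace K := hKc.completeSpace_coe
  let e : H →L[ℂ] H := K.starProjection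
  have he : IsStarProjection e := isStarProjection_starProjection
  have heM : e ∈ M := by
    rw [IsStarProjection.mem_iff he]
    intro u hu x hx
    have hx' : c x = 0 := by
      rw [Submodule.range_starProjection] at hx
      exact hx
    rw [Submodule.mem_comap, Submodule.range_starProjection]
    have h1 : c (u x) = u (c x) :=
      congrArg (fun T : H →L[ℂ] H => T x) (commute_of_mem_commutant hcM hu).eq
    exact LinearMap.mem_ker.mpr (by simpa [hx'] using h1)
  have hce : c * e = 0 := by
    ext x
    exact LinearMap.mem_ker.mp (K.starProjection_apply_mem x)
  have hed : e * d = d := by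
    ext x
    refine Submodule.starProjection_eq_self_iff.mpr ?_
    exact congrArg (fun T : H →L[ℂ] H => T x) hcd
  have hec : e * c = 0 := by
    have := congrArg star hce
    rwa [star_mul, star_zero, he.isSelfAdjoint.star_eq, (IsSelfAdjoint.of_nonneg hc0).star_eq]
      at this
  have hde : d * e = d := by
    have := congrArg star hed
    rwa [star_mul, he.isSelfAdjoint.star_eq, (IsSelfAdjoint.of_nonneg hd0).star_eq] at this
  have hee : e * e = e := he.isIdempotentElem.eq
  have h2a : a + a = c - d + 1 := by rw [← hbcd, hb, sub_add_cancel]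
  -- `p = 1 - e` is the support projection of `(2a - 1)⁺`. On its range `2a - p` is `2a - 1`, on the
  -- complement it is `2a`.
  refine ⟨1 - e, sub_mem (one_mem M) heM, he.one_sub, ?_, ?_⟩
  · have h1 : 0 ≤ star e * (a + a) * e := star_left_conjugate_nonneg (add_nonneg ha ha) e
    have h2 : a + a - (1 - e) = c + star e * (a + a) * e := by
      rw [he.isSelfAdjoint.star_eq, h2a]
      simp only [mul_add, mul_sub, add_mul, sub_mul, mul_one, hec, hed, hde, hee, zero_mul]
      abel
    rw [h2]
    exact add_nonneg hc0 h1
  · have h1 : 0 ≤ star (1 - e) * ((1 - a) + (1 - a)) * (1 - e) :=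
      star_left_conjugate_nonneg (add_nonneg (sub_nonneg.mpr ha1) (sub_nonneg.mpr ha1)) _
    have h2 : 1 - (a + a - (1 - e)) = star (1 - e) * ((1 - a) + (1 - a)) * (1 - e) + d := by
      have h3 : (1 - a) + (1 - a) = 1 - (c - d) := by
        rw [← sub_eq_of_eq_add h2a]; abel
      rw [he.one_sub.isSelfAdjoint.star_eq, h3, h2a]
      simp only [mul_sub, sub_mul, mul_one, one_mul, hec, hed, hde, hee, hce, zero_mul]
      abel
    rw [← sub_nonneg, h2]
    exact add_nonneg h1 hd0

variable {M : VonNeumannAlgebra H} {E : (H →L[ℂ] H) →ₗ[ℂ] (H →L[ℂ] H)}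

/-- The defect `E (a * x) - a * E x` is linear in `a` and vanishes on projections, so passing from
`a` to `2a - p` doubles it. All these elements are positive contractions, whose defects are at most
`2‖x‖`; hence the defect is zero. This is the binary expansion of `a` in projections. -/
theorem map_mul_of_contractive_of_le_one (hE : ∀ x, ‖E x‖ ≤ ‖x‖) (hEM : ∀ x, E x ∈ M)
    (hEid : ∀ x ∈ M, E x = x) {a : H →L[ℂ] H} (haM : a ∈ M) (ha : 0 ≤ a) (ha1 : a ≤ 1)
    (x : H →L[ℂ] H) : E (a * x) = a * E x := by
  have key : ∀ n : ℕ, ∀ a ∈ M, 0 ≤ a → a ≤ 1 → 2 ^ n * ‖E (a * x) - a * E x‖ ≤ 2 * ‖x‖ := by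
    intro n
    induction n with
    | zero =>
      intro a _ ha ha1
      have han : ‖a‖ ≤ 1 := (CStarAlgebra.norm_le_norm_of_nonneg_of_le ha ha1).trans
        ContinuousLinearMap.norm_id_le
      rw [pow_zero, one_mul, two_mul]
      refine (norm_sub_le _ _).trans (add_le_add ?_ ?_)
      · exact (hE _).trans ((norm_mul_le _ _).trans (mul_le_of_le_one_left (norm_nonneg x) han))
      · exact (norm_mul_le _ _).trans ((mul_le_of_le_one_left (norm_nonneg _) han).trans (hE x))
    | succ n ih =>
      intro a haM ha ha1
      obtain ⟨p, hpM, hp, h0, h1⟩ := exists_isStarProjection haM ha ha1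
      have h2 := ih (a + a - p) (sub_mem (add_mem haM haM) hpM) h0 h1
      have h3 := ContinuousLinearMap.mul_map_of_isStarProjection hE (M := M) hEM hEid
        (fun _ h _ h' => mul_mem h h') hp hpM (sub_mem (one_mem M) hpM) x
      have h4 : E ((a + a - p) * x) - (a + a - p) * E x =
          (2 : ℂ) • (E (a * x) - a * E x) := by
        simp only [sub_mul, add_mul, map_sub, map_add, h3, two_smul]
        abel
      rw [h4, norm_smul] at h2
      rw [pow_succ, mul_assoc]
      simpa using h2
  by_contra hne
  have hpos : 0 < ‖E (a * x) - a * E x‖ := norm_pos_iff.mpr (sub_ne_zero.mpr hne)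
  obtain ⟨n, hn⟩ := pow_unbounded_of_one_lt (2 * ‖x‖ / ‖E (a * x) - a * E x‖) (one_lt_two (α := ℝ))
  rw [div_lt_iff₀ hpos] at hn
  exact absurd (key n a haM ha ha1) (not_le.mpr hn)

theorem map_mul_of_contractive (hE : ∀ x, ‖E x‖ ≤ ‖x‖) (hEM : ∀ x, E x ∈ M)
    (hEid : ∀ x ∈ M, E x = x) {a : H →L[ℂ] H} (haM : a ∈ M) (x : H →L[ℂ] H) :
    E (a * x) = a * E x := by
  have smulM : ∀ (c : ℂ) (y : H →L[ℂ] H), y ∈ M → c • y ∈ M := fun c y hy =>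
    M.toStarSubalgebra.smul_mem hy c
  have hsa : ∀ a ∈ M, IsSelfAdjoint a → E (a * x) = a * E x := by
    intro a haM ha
    -- With this `r`, `0 ≤ a + r ≤ 2r`, so `(a + r) / 2r` is a positive contraction; the scalar
    -- shift satisfies the identity trivially.
    set r : ℝ := ‖a‖ + 1
    have hr : 0 < r := by positivity
    have h1 : 0 ≤ a + (r : ℂ) • 1 := by
      have h := ha.neg_algebraMap_norm_le_self
      rw [← sub_nonneg, sub_neg_eq_add, Algebra.algebraMap_eq_smul_one] at h
      have h' : a + (r : ℂ) • (1 : H →L[ℂ] H) = a + ‖a‖ • 1 + 1 := by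
        simp only [r, Complex.coe_smul, add_smul, one_smul, add_assoc]
      rw [h']
      exact add_nonneg h zero_le_one
    have h2 : a + (r : ℂ) • 1 ≤ ((2 * r : ℝ) : ℂ) • 1 := by
      have h := ha.le_algebraMap_norm_self
      rw [Algebra.algebraMap_eq_smul_one, ← sub_nonneg] at h
      have h' : ((2 * r : ℝ) : ℂ) • (1 : H →L[ℂ] H) - (a + (r : ℂ) • 1) = (‖a‖ • 1 - a) + 1 := by
        simp only [r, Complex.coe_smul, add_smul, one_smul, two_mul]
        abel
      rw [← sub_nonneg, h']
      exact add_nonneg h zero_le_one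
    have hs : 0 ≤ (((2 * r)⁻¹ : ℝ) : ℂ) := by exact_mod_cast (by positivity : 0 ≤ (2 * r)⁻¹)
    have hs1 : (((2 * r)⁻¹ : ℝ) : ℂ) * ((2 * r : ℝ) : ℂ) = 1 := by
      rw [← Complex.ofReal_mul, inv_mul_cancel₀ (by positivity), Complex.ofReal_one]
    have h3 := map_mul_of_contractive_of_le_one hE hEM hEid
      (a := (((2 * r)⁻¹ : ℝ) : ℂ) • (a + (r : ℂ) • 1))
      (smulM _ _ (add_mem haM (smulM _ _ (one_mem M)))) (smul_nonneg hs h1) (by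
        have := smul_le_smul_of_nonneg_left h2 hs
        rwa [smul_smul, hs1, one_smul] at this) x
    simp only [smul_mul_assoc, map_smul, add_mul, map_add, one_mul] at h3
    have h4 := congrArg (fun T => ((2 * r : ℝ) : ℂ) • T) h3
    simp only [smul_smul, mul_comm ((2 * r : ℝ) : ℂ), hs1, one_smul] at h4
    exact add_right_cancel h4
  have h1 : a = (realPart a : H →L[ℂ] H) + Complex.I • (imaginaryPart a : H →L[ℂ] H) :=
    (realPart_add_I_smul_imaginaryPart a).symm
  have h2 : (realPart a : H →L[ℂ] H) ∈ M := by
    rw [realPart_apply_coe, ← Complex.coe_smul]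
    exact smulM _ _ (add_mem haM (star_mem haM))
  have h3 : (imaginaryPart a : H →L[ℂ] H) ∈ M := by
    rw [imaginaryPart_apply_coe, ← Complex.coe_smul]
    exact smulM _ _ (smulM _ _ (sub_mem haM (star_mem haM)))
  rw [h1, add_mul, add_mul, map_add, smul_mul_assoc, smul_mul_assoc, map_smul,
    hsa _ h2 (realPart a).2, hsa _ h3 (imaginaryPart a).2]

end VonNeumannAlgebra

end

/-! ### Complete positivity of contractive projections, and injectivity -/

noncomputable section

open scoped InnerProductSpace ComplexOrder ComplexConjugate

/-- A positive map `E` with values in a C⋆-subalgebra `A` is completely positive if it is an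
`A`-bimodule map. -/
theorem CStarMatrix.map_nonneg_of_bimodule {A B : Type*} [CStarAlgebra A] [PartialOrder A]
    [StarOrderedRing A] [CStarAlgebra B] [PartialOrder B] [StarOrderedRing B]
    (ι : A →⋆ₐ[ℂ] B) (hι : Function.Injective ι) {E : B →ₗ[ℂ] B} (hE : ∀ x, 0 ≤ x → 0 ≤ E x)
    (hEι : ∀ x, ∃ a, ι a = E x) (hEl : ∀ a x, E (ι a * x) = ι a * E x)
    (hEr : ∀ a x, E (x * ι a) = E x * ι a) (hEs : ∀ x, E (star x) = star (E x))
    {n : ℕ} {X : CStarMatrix (Fin n) (Fin n) B} (hX : 0 ≤ X) : 0 ≤ X.map E := by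
  obtain ⟨b, hb⟩ := CStarMatrix.exists_eq_sum_of_nonneg hX
  choose e he using hEι
  let Y : CStarMatrix (Fin n) (Fin n) A := CStarMatrix.ofMatrix fun i j => e (X i j)
  have hYX : Y.map ι = X.map E := by
    ext i j
    exact he _
  have hY : 0 ≤ Y := by
    refine CStarMatrix.nonneg_of_forall_sum ?_ fun r => ?_
    · ext1 i j
      apply hι
      change ι (star (e (X j i))) = ι (e (X i j))
      rw [map_star, he, he, ← hEs, ← CStarMatrix.star_apply, (IsSelfAdjoint.of_nonneg hX).star_eq]
    · refine ArvesonExtension.nonneg_of_map_nonneg ι hι ?_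
      -- The bimodule property moves the coefficients `r i` inside `E`, where the quadratic form is
      -- a sum of squares.
      have h1 : ι (∑ i, ∑ j, star (r i) * Y i j * r j) =
          E (∑ k, star (∑ i, b k i * ι (r i)) * ∑ j, b k j * ι (r j)) := by
        calc _ = ∑ i, ∑ j, E (star (ι (r i)) * X i j * ι (r j)) := by
              simp only [map_sum, map_mul, map_star]
              refine Finset.sum_congr rfl fun i _ => Finset.sum_congr rfl fun j _ => ?_
              rw [hEr, ← map_star, hEl]
              exact congrArg (fun y => ι (star (r i)) * y * ι (r j)) (he _)
          _ = ∑ i, ∑ j, ∑ k, E (star (b k i * ι (r i)) * (b k j * ι (r j))) := by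
              simp only [hb, Finset.mul_sum, Finset.sum_mul, map_sum, star_mul, mul_assoc]
          _ = ∑ k, ∑ i, ∑ j, E (star (b k i * ι (r i)) * (b k j * ι (r j))) :=
              (Finset.sum_congr rfl fun i _ => Finset.sum_comm).trans Finset.sum_comm
          _ = _ := by simp only [star_sum, Finset.sum_mul_sum, map_sum]
      rw [h1]
      exact hE _ (Finset.sum_nonneg fun k _ => star_mul_self_nonneg _)
  rw [← hYX]
  exact CompletelyPositiveMapClass.map_cstarMatrix_nonneg' ι _ Y hY

namespace VonNeumannAlgebra

variable {H : Type u} [NormedAddCommGroup H] [InnerProductSpace ℂ H] [CompleteSpace H]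

/-- Provides the C⋆-algebra structure on `M`. -/
instance isClosed_toStarSubalgebra (M : VonNeumannAlgebra H) :
    IsClosed (M.toStarSubalgebra : Set (H →L[ℂ] H)) := by
  rw [coe_toStarSubalgebra, ← centralizer_centralizer]
  exact Set.isClosed_centralizer _

variable {M : VonNeumannAlgebra H}

theorem map_star_of_contractive {E : (H →L[ℂ] H) →ₗ[ℂ] (H →L[ℂ] H)} (hE : ∀ x, ‖E x‖ ≤ ‖x‖)
    (hE1 : E 1 = 1) (x : H →L[ℂ] H) : E (star x) = star (E x) :=
  map_star (PositiveLinearMap.mk₀ E fun _ => ContinuousLinearMap.map_nonneg_of_contractive hE hE1) x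

/-- **Tomiyama's theorem**: a contractive projection onto a von Neumann algebra is completely
positive. -/
theorem map_nonneg_of_contractive {E : (H →L[ℂ] H) →ₗ[ℂ] (H →L[ℂ] H)}
    (hE : ∀ x, ‖E x‖ ≤ ‖x‖) (hEM : ∀ x, E x ∈ M) (hEid : ∀ x ∈ M, E x = x)
    {n : ℕ} {X : CStarMatrix (Fin n) (Fin n) (H →L[ℂ] H)} (hX : 0 ≤ X) : 0 ≤ X.map E := by
  let := CStarAlgebra.spectralOrder M.toStarSubalgebra
  let := CStarAlgebra.spectralOrderedRing M.toStarSubalgebra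
  have hE1 : E 1 = 1 := hEid 1 (one_mem M)
  have hEs := map_star_of_contractive hE hE1
  refine CStarMatrix.map_nonneg_of_bimodule M.toStarSubalgebra.subtype Subtype.val_injective
    (fun x => ContinuousLinearMap.map_nonneg_of_contractive hE hE1) (fun x => ⟨⟨E x, hEM x⟩, rfl⟩)
    (fun a x => map_mul_of_contractive hE hEM hEid a.2 x) (fun a x => ?_) hEs hX
  have := map_mul_of_contractive hE hEM hEid (star_mem a.2) (star x)
  rw [← star_mul, hEs, hEs, ← star_mul] at this
  exact star_injective this

theorem isInjective_of_contractivelyComplemented (h : ContractivelyComplemented M.toSubspace) :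
    IsInjective.{u, w} M := by
  obtain ⟨P, hP, hPn⟩ := h
  let E : (H →L[ℂ] H) →ₗ[ℂ] (H →L[ℂ] H) := M.toSubspace.subtype ∘ₗ P.toLinearMap
  have hE : ∀ x, ‖E x‖ ≤ ‖x‖ := fun x =>
    (P.le_opNorm x).trans (mul_le_of_le_one_left (norm_nonneg x) hPn)
  have hEM : ∀ x, E x ∈ M := fun x => (P x).2
  have hEid : ∀ x ∈ M, E x = x := fun x hx => congrArg Subtype.val (hP ⟨x, hx⟩)
  intro A B _ _ _ _ _ _ ι hι φ hφ
  obtain ⟨ψ, hψ, -⟩ := CompletelyPositiveMap.exists_extension ι hι φ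
  refine ⟨⟨E ∘ₗ ψ.toLinearMap, fun k X hX => ?_⟩, fun b => hEM _, fun a => ?_⟩
  · exact map_nonneg_of_contractive hE hEM hEid (ψ.map_cstarMatrix_nonneg' k X hX)
  · exact (congrArg E (hψ a)).trans (hEid _ (hφ a))

end VonNeumannAlgebra

end

/-! ### Operators on the Hilbert tensor product and slice maps -/

noncomputable section

open scoped InnerProductSpace ComplexOrder ComplexConjugate
open UniformSpace (Completion)

section HilbertTensor

variable {H : Type*} [NormedAddCommGroup H] [InnerProductSpace ℂ H]
variable {K : Type*} [NormedAddCommGroup K] [InnerProductSpace ℂ K]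

namespace HilbertTensor

/-- The elementary tensor `x ⊗ y`, as a bounded bilinear map. -/
def mkL (H K : Type*) [NormedAddCommGroup H] [InnerProductSpace ℂ H]
    [NormedAddCommGroup K] [InnerProductSpace ℂ K] : H →L[ℂ] K →L[ℂ] HilbertTensor H K :=
  (ContinuousLinearMap.compL ℂ K (H ⊗[ℂ] K) (HilbertTensor H K) Completion.toComplL) ∘L
    TensorProduct.mkL ℂ H K

theorem mkL_apply (x : H) (y : K) :
    mkL H K x y = ((x ⊗ₜ[ℂ] y : H ⊗[ℂ] K) : HilbertTensor H K) := rfl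

theorem norm_mkL_apply_apply (x : H) (y : K) : ‖mkL H K x y‖ = ‖x‖ * ‖y‖ := by
  rw [mkL_apply, Completion.norm_coe, TensorProduct.norm_tmul]

theorem norm_mkL_flip_apply_le (y : K) : ‖(mkL H K).flip y‖ ≤ ‖y‖ :=
  ContinuousLinearMap.opNorm_le_bound _ (norm_nonneg y) fun x =>
    (norm_mkL_apply_apply x y).le.trans (mul_comm _ _).le

theorem inner_mkL (x x' : H) (y y' : K) :
    ⟪mkL H K x y, mkL H K x' y'⟫_ℂ = ⟪x, x'⟫_ℂ * ⟪y, y'⟫_ℂ := by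
  rw [mkL_apply, mkL_apply, Completion.inner_coe, TensorProduct.inner_tmul]

theorem clm_ext {F : Type*} [NormedAddCommGroup F] [NormedSpace ℂ F]
    {S T : HilbertTensor H K →L[ℂ] F} (h : ∀ x y, S (mkL H K x y) = T (mkL H K x y)) : S = T := by
  ext z
  induction z using Completion.induction_on with
  | hp => exact isClosed_eq S.continuous T.continuous
  | ih z =>
    induction z using TensorProduct.induction_on with
    | zero => rw [Completion.coe_zero, map_zero, map_zero]
    | tmul x y => exact h x y
    | add z w hz hw => rw [Completion.coe_add, map_add, map_add, hz, hw]

end HilbertTensor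

open HilbertTensor

theorem operatorTensor_mkL (a : H →L[ℂ] H) (b : K →L[ℂ] K) (x : H) (y : K) :
    operatorTensor a b (mkL H K x y) = mkL H K (a x) (b y) :=
  operatorTensor_tmul a b x y

theorem operatorTensor_mul (a a' : H →L[ℂ] H) (b b' : K →L[ℂ] K) :
    operatorTensor a b * operatorTensor a' b' = operatorTensor (a * a') (b * b') :=
  clm_ext fun x y => by
    simp only [ContinuousLinearMap.mul_def, ContinuousLinearMap.comp_apply, operatorTensor_mkL]

theorem norm_operatorTensor_le (a : H →L[ℂ] H) (b : K →L[ℂ] K) :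
    ‖operatorTensor a b‖ ≤ ‖a‖ * ‖b‖ := by
  refine ContinuousLinearMap.opNorm_le_bound _ (by positivity) fun z => ?_
  induction z using Completion.induction_on with
  | hp => exact isClosed_le (operatorTensor a b).continuous.norm (by fun_prop)
  | ih z =>
    rw [operatorTensor, ContinuousLinearMap.completion_apply_coe, Completion.norm_coe,
      Completion.norm_coe]
    exact (ContinuousLinearMap.le_opNorm _ _).trans
      (mul_le_mul_of_nonneg_right (TensorProduct.norm_mapL_le a b) (norm_nonneg z))

theorem operatorTensor_add_right (a : H →L[ℂ] H) (b b' : K →L[ℂ] K) :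
    operatorTensor a (b + b') = operatorTensor a b + operatorTensor a b' :=
  clm_ext fun x y => by
    simp only [add_apply, operatorTensor_mkL, map_add]

theorem operatorTensor_smul_right (c : ℂ) (a : H →L[ℂ] H) (b : K →L[ℂ] K) :
    operatorTensor a (c • b) = c • operatorTensor a b :=
  clm_ext fun x y => by
    simp only [smul_apply, operatorTensor_mkL, map_smul]

theorem operatorTensor_add_left (a a' : H →L[ℂ] H) (b : K →L[ℂ] K) :
    operatorTensor (a + a') b = operatorTensor a b + operatorTensor a' b :=
  clm_ext fun x y => by
    simp only [add_apply, operatorTensor_mkL, map_add]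

theorem operatorTensor_smul_left (c : ℂ) (a : H →L[ℂ] H) (b : K →L[ℂ] K) :
    operatorTensor (c • a) b = c • operatorTensor a b :=
  clm_ext fun x y => by
    simp only [smul_apply, operatorTensor_mkL, map_smul]

variable [CompleteSpace H] [CompleteSpace K]

theorem inner_mkL_star (a : H →L[ℂ] H) (b : K →L[ℂ] K) (x : H) (y : K) (z : HilbertTensor H K) :
    ⟪mkL H K (star a x) (star b y), z⟫_ℂ = ⟪mkL H K x y, operatorTensor a b z⟫_ℂ := by
  have : innerSL ℂ (mkL H K (star a x) (star b y)) =
      (innerSL ℂ (mkL H K x y)) ∘L operatorTensor a b := clm_ext fun x' y' => by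
    simp only [innerSL_apply_apply, ContinuousLinearMap.comp_apply, operatorTensor_mkL, inner_mkL,
      ContinuousLinearMap.star_eq_adjoint, ContinuousLinearMap.adjoint_inner_left]
  exact congrArg (fun T : HilbertTensor H K →L[ℂ] ℂ => T z) this

theorem star_operatorTensor (a : H →L[ℂ] H) (b : K →L[ℂ] K) :
    star (operatorTensor a b) = operatorTensor (star a) (star b) := by
  rw [ContinuousLinearMap.star_eq_adjoint, eq_comm]
  refine clm_ext fun x y => ?_
  refine ext_inner_right ℂ fun z => ?_
  rw [ContinuousLinearMap.adjoint_inner_left, operatorTensor_mkL, inner_mkL_star]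

namespace HilbertTensor

/-- The slice map `id ⊗ ω` for the vector functional `ω` of `ξ` and `η`. -/
def sliceRight (X : HilbertTensor H K →L[ℂ] HilbertTensor H K) (ξ η : K) : H →L[ℂ] H :=
  ((mkL H K).flip η).adjoint ∘L X ∘L (mkL H K).flip ξ

/-- The slice map `ω ⊗ id` for the vector functional `ω` of `ξ` and `η`. -/
def sliceLeft (X : HilbertTensor H K →L[ℂ] HilbertTensor H K) (ξ η : H) : K →L[ℂ] K :=
  (mkL H K η).adjoint ∘L X ∘L mkL H K ξ

theorem inner_sliceRight (X : HilbertTensor H K →L[ℂ] HilbertTensor H K) (ξ η : K) (x y : H) :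
    ⟪y, sliceRight X ξ η x⟫_ℂ = ⟪mkL H K y η, X (mkL H K x ξ)⟫_ℂ :=
  ContinuousLinearMap.adjoint_inner_right ((mkL H K).flip η) y (X (mkL H K x ξ))

theorem inner_sliceLeft (X : HilbertTensor H K →L[ℂ] HilbertTensor H K) (ξ η : H) (x y : K) :
    ⟪y, sliceLeft X ξ η x⟫_ℂ = ⟪mkL H K η y, X (mkL H K ξ x)⟫_ℂ :=
  ContinuousLinearMap.adjoint_inner_right (mkL H K η) y (X (mkL H K ξ x))

end HilbertTensor

theorem Commute.clm_apply {E : Type*} [NormedAddCommGroup E] [NormedSpace ℂ E] {S T : E →L[ℂ] E}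
    (h : Commute S T) (x : E) : S (T x) = T (S x) :=
  congrArg (fun R : E →L[ℂ] E => R x) h.eq

namespace VonNeumannAlgebra

variable {M : VonNeumannAlgebra H} {N : VonNeumannAlgebra K}

/-- The easy half of the commutation theorem, checked on generators; it is all that slicing needs.
-/
theorem operatorTensor_mem_commutant_tensor {u : H →L[ℂ] H} {v : K →L[ℂ] K}
    (hu : u ∈ M.commutant) (hv : v ∈ N.commutant) :
    operatorTensor u v ∈ (M.tensor N).commutant := by
  have h1 : operatorTensor u v ∈ Set.centralizer
      ({T | ∃ a ∈ M, ∃ b ∈ N, T = operatorTensor a b} ∪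
        star {T | ∃ a ∈ M, ∃ b ∈ N, T = operatorTensor a b}) := by
    have h2 : ∀ a ∈ M, ∀ b ∈ N, operatorTensor a b * operatorTensor u v =
        operatorTensor u v * operatorTensor a b := fun a ha b hb => by
      rw [operatorTensor_mul, operatorTensor_mul, (commute_of_mem_commutant ha hu).eq,
        (commute_of_mem_commutant hb hv).eq]
    rintro T (⟨a, ha, b, hb, rfl⟩ | ⟨a, ha, b, hb, hT⟩)
    · exact h2 a ha b hb
    · have : T = operatorTensor (star a) (star b) := by
        rw [← star_operatorTensor, ← hT, star_star]
      rw [this]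
      exact h2 _ (star_mem ha) _ (star_mem hb)
  rw [mem_commutant_iff]
  intro X hX
  rw [← SetLike.mem_coe, tensor, coe_generatedBy] at hX
  exact (hX _ h1).symm

/-- Slicing the second variable of an element of `M ⊗ N` gives an element of `M`. -/
theorem sliceRight_mem {X : HilbertTensor H K →L[ℂ] HilbertTensor H K}
    (hX : X ∈ M.tensor N) (ξ η : K) : sliceRight X ξ η ∈ M := by
  refine mem_of_forall_commute fun u hu => ?_
  -- `u ⊗ 1` commutes with `X`, and slicing the second variable carries this to the slice; the
  -- bicommutant theorem concludes.
  have h1 := commute_of_mem_commutant hX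
    (operatorTensor_mem_commutant_tensor hu (one_mem N.commutant))
  ext x
  refine ext_inner_left ℂ fun y => ?_
  have h2 : ⟪y, u (sliceRight X ξ η x)⟫_ℂ = ⟪star u y, sliceRight X ξ η x⟫_ℂ :=
    (ContinuousLinearMap.adjoint_inner_left u _ _).symm
  have h3 := operatorTensor_mkL u (1 : K →L[ℂ] K) x ξ
  have h4 := inner_mkL_star u (1 : K →L[ℂ] K) y η (X (mkL H K x ξ))
  rw [star_one] at h4
  change ⟪y, u (sliceRight X ξ η x)⟫_ℂ = ⟪y, sliceRight X ξ η (u x)⟫_ℂ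
  rw [h2, inner_sliceRight, inner_sliceRight]
  refine h4.trans ?_
  rw [← h1.clm_apply, h3]
  rfl

/-- Slicing the first variable of an element of `M ⊗ N` gives an element of `N`. -/
theorem sliceLeft_mem {X : HilbertTensor H K →L[ℂ] HilbertTensor H K}
    (hX : X ∈ M.tensor N) (ξ η : H) : sliceLeft X ξ η ∈ N := by
  refine mem_of_forall_commute fun u hu => ?_
  have h1 := commute_of_mem_commutant hX
    (operatorTensor_mem_commutant_tensor (one_mem M.commutant) hu)
  ext x
  refine ext_inner_left ℂ fun y => ?_
  have h2 : ⟪y, u (sliceLeft X ξ η x)⟫_ℂ = ⟪star u y, sliceLeft X ξ η x⟫_ℂ :=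
    (ContinuousLinearMap.adjoint_inner_left u _ _).symm
  have h3 := operatorTensor_mkL (1 : H →L[ℂ] H) u ξ x
  have h4 := inner_mkL_star (1 : H →L[ℂ] H) u η y (X (mkL H K ξ x))
  rw [star_one] at h4
  change ⟪y, u (sliceLeft X ξ η x)⟫_ℂ = ⟪y, sliceLeft X ξ η (u x)⟫_ℂ
  rw [h2, inner_sliceLeft, inner_sliceLeft]
  refine h4.trans ?_
  rw [← h1.clm_apply, h3]
  rfl

end VonNeumannAlgebra
end HilbertTensor

end

/-! ### Duality for projections and the square-root estimate -/

noncomputable section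

open scoped InnerProductSpace ComplexOrder ComplexConjugate
open HilbertTensor

section Triples

variable {B : Type*} [SeminormedAddCommGroup B] [NormedSpace ℂ B]
variable {H : Type*} [NormedAddCommGroup H] [InnerProductSpace ℂ H]

/-- The pairing of a linear map `T` into the bounded operators with formal sums of triples. -/
def triplePairing (T : B →ₗ[ℂ] H →L[ℂ] H) : ((B × H × H) →₀ ℂ) →ₗ[ℂ] ℂ :=
  Finsupp.linearCombination ℂ fun t => ⟪t.2.2, T t.1 t.2.1⟫_ℂ

theorem triplePairing_single (T : B →ₗ[ℂ] H →L[ℂ] H) (b : B) (ξ η : H) (c : ℂ) :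
    triplePairing T (Finsupp.single (b, ξ, η) c) = c * ⟪η, T b ξ⟫_ℂ := by
  simp [triplePairing]

theorem triplePairing_apply (T : B →ₗ[ℂ] H →L[ℂ] H) (v : (B × H × H) →₀ ℂ) :
    triplePairing T v = ∑ t ∈ v.support, v t * ⟪t.2.2, T t.1 t.2.1⟫_ℂ := by
  rw [triplePairing, Finsupp.linearCombination_apply, Finsupp.sum]
  rfl

variable (B H) in
/-- The projective seminorm on formal sums of triples. -/
def tripleSeminorm : Seminorm ℂ ((B × H × H) →₀ ℂ) :=
  Seminorm.of (fun v => ∑ t ∈ v.support, ‖v t‖ * (‖t.1‖ * ‖t.2.1‖ * ‖t.2.2‖))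
    (fun v w => by
      classical
      have h : ∀ u : (B × H × H) →₀ ℂ, u.support ⊆ v.support ∪ w.support →
          ∑ t ∈ u.support, ‖u t‖ * (‖t.1‖ * ‖t.2.1‖ * ‖t.2.2‖) =
          ∑ t ∈ v.support ∪ w.support, ‖u t‖ * (‖t.1‖ * ‖t.2.1‖ * ‖t.2.2‖) := fun u hu =>
        Finset.sum_subset hu fun t _ ht => by
          rw [Finsupp.notMem_support_iff.mp ht, norm_zero, zero_mul]
      rw [h _ Finsupp.support_add, h v Finset.subset_union_left, h w Finset.subset_union_right,
        ← Finset.sum_add_distrib]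
      refine Finset.sum_le_sum fun t _ => ?_
      rw [← add_mul]
      exact mul_le_mul_of_nonneg_right (norm_add_le _ _) (by positivity))
    (fun c v => by
      rw [Finset.mul_sum]
      refine (Finset.sum_subset Finsupp.support_smul fun t _ ht => ?_).trans
        (Finset.sum_congr rfl fun t _ => ?_)
      · rw [Finsupp.notMem_support_iff.mp ht, norm_zero, zero_mul]
      · rw [Finsupp.smul_apply, norm_smul, mul_assoc])

theorem tripleSeminorm_apply (v : (B × H × H) →₀ ℂ) :
    tripleSeminorm B H v = ∑ t ∈ v.support, ‖v t‖ * (‖t.1‖ * ‖t.2.1‖ * ‖t.2.2‖) := rfl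

theorem norm_triplePairing_le {T : B →ₗ[ℂ] H →L[ℂ] H} {C : ℝ} (hT : ∀ b, ‖T b‖ ≤ C * ‖b‖)
    (v : (B × H × H) →₀ ℂ) : ‖triplePairing T v‖ ≤ C * tripleSeminorm B H v := by
  rw [triplePairing_apply, tripleSeminorm_apply, Finset.mul_sum]
  refine (norm_sum_le _ _).trans (Finset.sum_le_sum fun t _ => ?_)
  rw [norm_mul]
  calc ‖v t‖ * ‖⟪t.2.2, T t.1 t.2.1⟫_ℂ‖ ≤ ‖v t‖ * (‖t.2.2‖ * (C * ‖t.1‖ * ‖t.2.1‖)) := by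
        gcongr
        refine (norm_inner_le_norm _ _).trans ?_
        gcongr
        exact (T t.1).le_of_opNorm_le (hT _) _
    _ = _ := by ring

end Triples

namespace VonNeumannAlgebra

variable {H : Type u} [NormedAddCommGroup H] [InnerProductSpace ℂ H] [CompleteSpace H]
variable {K : Type v} [NormedAddCommGroup K] [InnerProductSpace ℂ K] [CompleteSpace K]

/-- `E` is a linear projection of `B(H)` onto `M`. -/
structure IsProjectionOnto (M : VonNeumannAlgebra H) (E : (H →L[ℂ] H) →ₗ[ℂ] H →L[ℂ] H) :
    Prop where
  mem : ∀ x, E x ∈ M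
  eq_self : ∀ x ∈ M, E x = x

/-- There is a linear projection of `B(H)` onto `M` of norm at most `C`. -/
def HasProjection (M : VonNeumannAlgebra H) (C : ℝ) : Prop :=
  ∃ E : (H →L[ℂ] H) →ₗ[ℂ] H →L[ℂ] H, M.IsProjectionOnto E ∧ ∀ x, ‖E x‖ ≤ C * ‖x‖

/-- The formal sums of triples on which all multiples of projections onto `M` agree, up to
scaling, with `E`. -/
def determinedTriples (M : VonNeumannAlgebra H) (E : (H →L[ℂ] H) →ₗ[ℂ] H →L[ℂ] H) :
    Submodule ℂ (((H →L[ℂ] H) × H × H) →₀ ℂ) where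
  carrier := {v | ∀ (T : (H →L[ℂ] H) →ₗ[ℂ] H →L[ℂ] H) (c : ℂ), (∀ x, T x ∈ M) →
    (∀ x ∈ M, T x = c • x) → triplePairing T v = c * triplePairing E v}
  zero_mem' := fun T c _ _ => by simp
  add_mem' := fun {v w} hv hw T c h h' => by
    rw [map_add, map_add, hv T c h h', hw T c h h', mul_add]
  smul_mem' := fun a v hv T c h h' => by
    rw [map_smul, map_smul, hv T c h h', smul_eq_mul, smul_eq_mul, mul_left_comm]

variable {M : VonNeumannAlgebra H} {N : VonNeumannAlgebra K}

/-- A Hahn–Banach extension of the pairing with `E` is again the pairing with a projection onto `M`,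
because trilinearity, commutation with `M'` and the identity on `M` are all conditions on determined
triples. -/
theorem hasProjection_of_forall_le {E : (H →L[ℂ] H) →ₗ[ℂ] H →L[ℂ] H} (hE : M.IsProjectionOnto E)
    {C : ℝ} (hC : 0 ≤ C) (h : ∀ v ∈ M.determinedTriples E,
      ‖triplePairing E v‖ ≤ C * tripleSeminorm (H →L[ℂ] H) H v) : M.HasProjection C := by
  let W := M.determinedTriples E
  let c : NNReal := ⟨C, hC⟩
  obtain ⟨g, hgW, hg⟩ := Module.Dual.exists_extension_of_le_seminorm W
    ((triplePairing E).domRestrict W)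
    (p := c • tripleSeminorm (H →L[ℂ] H) H) fun x => h x x.2
  -- A difference `v - w` on which every map into `M` vanishes is determined with value `0`.
  have hgeq : ∀ v w, (∀ T : (H →L[ℂ] H) →ₗ[ℂ] H →L[ℂ] H, (∀ x, T x ∈ M) →
      triplePairing T v = triplePairing T w) → g v = g w := fun v w hvw => by
    have hmem : v - w ∈ W := fun T c hT _ => by
      rw [map_sub, map_sub, hvw T hT, hvw E hE.mem, sub_self, sub_self, mul_zero]
    rw [← sub_eq_zero, ← map_sub]
    refine (hgW ⟨v - w, hmem⟩).trans ?_
    change triplePairing E (v - w) = 0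
    rw [map_sub, hvw E hE.mem, sub_self]
  obtain ⟨T, hT, hTn⟩ := exists_linearMap_of_bounded_form
    (fun b ξ η => g (Finsupp.single (b, ξ, η) 1))
    (fun b b' ξ η => by
      rw [← map_add]
      exact hgeq _ _ fun T _ => by simp [triplePairing_single])
    (fun c b ξ η => by
      rw [← smul_eq_mul, ← map_smul]
      exact hgeq _ _ fun T _ => by simp [triplePairing_single])
    (fun b ξ ξ' η => by
      rw [← map_add]
      exact hgeq _ _ fun T _ => by simp [triplePairing_single])
    (fun c b ξ η => by
      rw [← smul_eq_mul, ← map_smul]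
      exact hgeq _ _ fun T _ => by simp [triplePairing_single])
    (fun b ξ η η' => by
      rw [← map_add]
      exact hgeq _ _ fun T _ => by simp [triplePairing_single])
    (fun c b ξ η => by
      rw [← smul_eq_mul, ← map_smul]
      exact hgeq _ _ fun T _ => by simp [triplePairing_single, mul_comm])
    hC (fun b ξ η => by
      refine (hg _).trans_eq ?_
      change C * tripleSeminorm (H →L[ℂ] H) H _ = _
      rw [tripleSeminorm_apply, Finsupp.support_single _ one_ne_zero,
        Finset.sum_singleton, Finsupp.single_eq_same, norm_one, one_mul])
  refine ⟨T, ⟨fun b => mem_of_forall_commute fun u hu => ?_, fun m hm => ?_⟩, hTn⟩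
  · ext ξ
    refine ext_inner_left ℂ fun η => ?_
    have h1 : ⟪η, u (T b ξ)⟫_ℂ = ⟪star u η, T b ξ⟫_ℂ :=
      (ContinuousLinearMap.adjoint_inner_left u _ _).symm
    refine h1.trans ((hT _ _ _).trans (Eq.trans ?_ (hT b (u ξ) η).symm))
    refine hgeq _ _ fun T hT => ?_
    rw [triplePairing_single, triplePairing_single,
      ← (commute_of_mem_commutant (hT b) hu).symm.clm_apply]
    congr 1
    exact ContinuousLinearMap.adjoint_inner_left u _ _
  · ext ξ
    refine ext_inner_left ℂ fun η => ?_
    rw [hT]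
    have hmem : Finsupp.single (m, ξ, η) 1 ∈ W := fun T c _ hT => by
      rw [triplePairing_single, triplePairing_single, hT m hm, hE.eq_self m hm, smul_apply,
        inner_smul_right, mul_left_comm]
    refine (hgW ⟨_, hmem⟩).trans ?_
    change triplePairing E (Finsupp.single (m, ξ, η) 1) = _
    rw [triplePairing_single, hE.eq_self m hm, one_mul]

/-- The map `x ↦ ∑ cₖ (id ⊗ ωₖ)(P (x ⊗ bₖ))` attached to a formal sum of triples. -/
def sliceSum (P : (HilbertTensor H K →L[ℂ] HilbertTensor H K) →ₗ[ℂ]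
      HilbertTensor H K →L[ℂ] HilbertTensor H K) (v : ((K →L[ℂ] K) × K × K) →₀ ℂ) :
    (H →L[ℂ] H) →ₗ[ℂ] H →L[ℂ] H where
  toFun x := ∑ t ∈ v.support, v t • sliceRight (P (operatorTensor x t.1)) t.2.1 t.2.2
  map_add' x y := by
    rw [← Finset.sum_add_distrib]
    refine Finset.sum_congr rfl fun t _ => ?_
    rw [operatorTensor_add_left, map_add, ← smul_add]
    congr 1
    ext z
    exact ext_inner_left ℂ fun y => by simp [inner_sliceRight, inner_add_right]
  map_smul' c x := by
    rw [RingHom.id_apply, Finset.smul_sum]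
    refine Finset.sum_congr rfl fun t _ => ?_
    rw [operatorTensor_smul_left, map_smul, smul_comm c]
    congr 1
    ext z
    exact ext_inner_left ℂ fun y => by simp [inner_sliceRight, inner_smul_right]

theorem norm_sliceRight_le (X : HilbertTensor H K →L[ℂ] HilbertTensor H K) (ξ η : K) :
    ‖sliceRight X ξ η‖ ≤ ‖X‖ * (‖ξ‖ * ‖η‖) := by
  refine (ContinuousLinearMap.opNorm_comp_le _ _).trans ?_
  rw [LinearIsometryEquiv.norm_map]
  calc _ ≤ ‖η‖ * (‖X‖ * ‖ξ‖) := by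
        gcongr
        · exact norm_mkL_flip_apply_le η
        · refine (ContinuousLinearMap.opNorm_comp_le _ _).trans ?_
          gcongr
          exact norm_mkL_flip_apply_le ξ
    _ = _ := by ring

section sliceSum

variable {P : (HilbertTensor H K →L[ℂ] HilbertTensor H K) →ₗ[ℂ]
      HilbertTensor H K →L[ℂ] HilbertTensor H K}

theorem norm_sliceSum_le {C : ℝ} (hC : 0 ≤ C) (hP : ∀ X, ‖P X‖ ≤ C * ‖X‖)
    (v : ((K →L[ℂ] K) × K × K) →₀ ℂ) (x : H →L[ℂ] H) :
    ‖sliceSum P v x‖ ≤ C * tripleSeminorm (K →L[ℂ] K) K v * ‖x‖ := by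
  rw [tripleSeminorm_apply, Finset.mul_sum, Finset.sum_mul]
  refine (norm_sum_le _ _).trans (Finset.sum_le_sum fun t _ => ?_)
  rw [norm_smul]
  calc _ ≤ ‖v t‖ * (C * (‖x‖ * ‖t.1‖) * (‖t.2.1‖ * ‖t.2.2‖)) := by
        gcongr
        refine (norm_sliceRight_le _ _ _).trans ?_
        gcongr
        exact (hP _).trans (by gcongr; exact norm_operatorTensor_le _ _)
    _ = _ := by ring

theorem sliceSum_mem (hP : ∀ X, P X ∈ M.tensor N) (v : ((K →L[ℂ] K) × K × K) →₀ ℂ)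
    (x : H →L[ℂ] H) : sliceSum P v x ∈ M :=
  sum_mem fun _ _ => M.toStarSubalgebra.smul_mem (sliceRight_mem (hP _) _ _) _

/-- The two slicings commute: the matrix coefficient of `sliceSum P v m` at `α`, `β` is the pairing
of `v` with `T : b ↦ (ω ⊗ id)(P (m ⊗ b))`. This `T` maps into `N` and is `⟪β, m α⟫` times the
identity on `N`, so a determined `v` sees only that scalar. Hence the arbitrary multiples in
`determinedTriples`. -/
theorem sliceSum_eq_smul (hP : (M.tensor N).IsProjectionOnto P)
    {E : (K →L[ℂ] K) →ₗ[ℂ] K →L[ℂ] K} {v : ((K →L[ℂ] K) × K × K) →₀ ℂ}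
    (hv : v ∈ N.determinedTriples E) {m : H →L[ℂ] H} (hm : m ∈ M) :
    sliceSum P v m = triplePairing E v • m := by
  ext α
  refine ext_inner_left ℂ fun β => ?_
  let T : (K →L[ℂ] K) →ₗ[ℂ] K →L[ℂ] K :=
    { toFun := fun b => sliceLeft (P (operatorTensor m b)) α β
      map_add' := fun b b' => by
        rw [operatorTensor_add_right, map_add]
        ext z
        exact ext_inner_left ℂ fun y => by simp [inner_sliceLeft, inner_add_right]
      map_smul' := fun c b => by
        rw [operatorTensor_smul_right, map_smul]
        ext z
        exact ext_inner_left ℂ fun y => by simp [inner_sliceLeft, inner_smul_right] }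
  have h1 : triplePairing T v = ⟪β, m α⟫_ℂ * triplePairing E v :=
    hv T _ (fun b => sliceLeft_mem (hP.mem _) _ _) fun n hn => by
      ext x
      refine ext_inner_left ℂ fun y => ?_
      have h2 : P (operatorTensor m n) = operatorTensor m n :=
        hP.eq_self _ (operatorTensor_mem_tensor hm hn)
      have h3 : ⟪y, T n x⟫_ℂ = ⟪mkL H K β y, P (operatorTensor m n) (mkL H K α x)⟫_ℂ :=
        inner_sliceLeft _ _ _ _ _
      rw [h3, h2, operatorTensor_mkL, inner_mkL, smul_apply, inner_smul_right]
  rw [smul_apply, inner_smul_right, mul_comm, ← h1, triplePairing_apply]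
  change ⟪β, (∑ t ∈ v.support, v t • sliceRight (P (operatorTensor m t.1)) t.2.1 t.2.2) α⟫_ℂ = _
  rw [sum_apply, inner_sum]
  refine Finset.sum_congr rfl fun t _ => ?_
  rw [smul_apply, inner_smul_right, inner_sliceRight]
  congr 1
  exact (inner_sliceLeft _ _ _ _ _).symm

end sliceSum

/-- A projection onto `M ⊗ M` yields a projection onto `M` whose norm is the square root. -/
theorem HasProjection.of_tensor {C C' : ℝ} (hC : 0 ≤ C) (hM : M.HasProjection C')
    (h : (M.tensor M).HasProjection C) : M.HasProjection (√C) := by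
  obtain ⟨E, hE, -⟩ := hM
  obtain ⟨P, hP, hPn⟩ := h
  by_cases hb : ∀ v ∈ M.determinedTriples E,
      ‖triplePairing E v‖ ≤ √C * tripleSeminorm (H →L[ℂ] H) H v
  · exact hasProjection_of_forall_le hE (Real.sqrt_nonneg C) hb
  · push Not at hb
    obtain ⟨v, hv, hlt⟩ := hb
    have hpos : 0 < ‖triplePairing E v‖ :=
      (mul_nonneg (Real.sqrt_nonneg C) (apply_nonneg _ v)).trans_lt hlt
    -- The norm is at most `C‖v‖ / |⟨E, v⟩|`, and `√C‖v‖ < |⟨E, v⟩|` by the choice of `v`.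
    refine ⟨(triplePairing E v)⁻¹ • sliceSum P v, ⟨fun x => ?_, fun x hx => ?_⟩, fun x => ?_⟩
    · exact M.toStarSubalgebra.smul_mem (sliceSum_mem hP.mem v x) _
    · rw [LinearMap.smul_apply, sliceSum_eq_smul hP hv hx, smul_smul,
        inv_mul_cancel₀ (norm_pos_iff.mp hpos), one_smul]
    · rw [LinearMap.smul_apply, norm_smul, norm_inv, inv_mul_le_iff₀ hpos]
      refine (norm_sliceSum_le hC hPn v x).trans ?_
      calc C * tripleSeminorm (H →L[ℂ] H) H v * ‖x‖
          = √C * (√C * tripleSeminorm (H →L[ℂ] H) H v) * ‖x‖ := by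
            rw [← mul_assoc √C, Real.mul_self_sqrt hC]
        _ ≤ √C * ‖triplePairing E v‖ * ‖x‖ := by gcongr
        _ = _ := by ring

/-- The least projection norm `s` is attained, and the square-root estimate then gives `s ≤ √s`. -/
theorem HasProjection.one_of_tensor {C : ℝ} (hC : 0 ≤ C) (hM : M.HasProjection C)
    (h : ∀ C, 0 ≤ C → M.HasProjection C → (M.tensor M).HasProjection C) : M.HasProjection 1 := by
  let S : Set ℝ := {C | 0 ≤ C ∧ M.HasProjection C}
  have hSne : S.Nonempty := ⟨C, hC, hM⟩
  have hSbdd : BddBelow S := ⟨0, fun _ hc => hc.1⟩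
  have h0 : 0 ≤ sInf S := le_csInf hSne fun _ hc => hc.1
  have hmin : M.HasProjection (sInf S) := by
    obtain ⟨E, hE, -⟩ := id hM
    refine hasProjection_of_forall_le hE h0 fun v hv => ?_
    -- Every projection has the same value at `v`, so each admissible norm bounds it, and the
    -- infimum inherits the bound.
    have h1 : ∀ c ∈ S, ‖triplePairing E v‖ ≤ c * tripleSeminorm (H →L[ℂ] H) H v := by
      rintro c ⟨hc, T, hT, hTn⟩
      have := hv T 1 hT.mem fun x hx => by rw [hT.eq_self x hx, one_smul]
      rw [← one_mul (triplePairing E v), ← this]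
      exact norm_triplePairing_le hTn v
    rcases (apply_nonneg (tripleSeminorm (H →L[ℂ] H) H) v).eq_or_lt with h2 | h2
    · have := h1 C ⟨hC, hM⟩
      rwa [← h2, mul_zero] at this ⊢
    · rw [← div_le_iff₀ h2]
      exact le_csInf hSne fun c hc => (div_le_iff₀ h2).mpr (h1 c hc)
  have hsq : sInf S ≤ √(sInf S) :=
    csInf_le hSbdd ⟨Real.sqrt_nonneg _, hmin.of_tensor h0 (h _ h0 hmin)⟩
  have h1 : sInf S ≤ 1 := by
    have h2 := Real.mul_self_sqrt h0
    nlinarith [Real.sqrt_nonneg (sInf S)]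
  obtain ⟨E, hE, hEn⟩ := hmin
  exact ⟨E, hE, fun x => (hEn x).trans (by gcongr)⟩

end VonNeumannAlgebra

end

/-! ### Transfer to a complemented subalgebra, and the conclusion -/

noncomputable section

namespace VonNeumannAlgebra

variable {H : Type u} [NormedAddCommGroup H] [InnerProductSpace ℂ H] [CompleteSpace H]
variable {K : Type v} [NormedAddCommGroup K] [InnerProductSpace ℂ K] [CompleteSpace K]
variable {M : VonNeumannAlgebra H} {N : VonNeumannAlgebra K}

theorem embedsContractivelyComplemented_of_starAlgEquiv
    (e : M.toStarSubalgebra ≃⋆ₐ[ℂ] N.toStarSubalgebra) : N.EmbedsContractivelyComplemented M := by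
  let π : N.toStarSubalgebra →⋆ₙₐ[ℂ] M.toStarSubalgebra := (e.symm : _ →⋆ₙₐ[ℂ] _)
  refine ⟨π, e.symm.injective,
    (ContinuousLinearMap.id ℂ _).codRestrict _ fun x => ⟨e x, e.symm_apply_apply x⟩,
    fun x => rfl, ContinuousLinearMap.opNorm_le_bound _ zero_le_one fun x => ?_⟩
  rw [one_mul]
  rfl

/-- A contractively complemented subalgebra has the projection bounds of the algebra. -/
theorem HasProjection.of_embedsContractivelyComplemented
    (h : N.EmbedsContractivelyComplemented M) {C : ℝ} (hC : 0 ≤ C) (hM : M.HasProjection C) :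
    N.HasProjection C := by
  obtain ⟨π, hπ, Q, hQ, hQn⟩ := h
  obtain ⟨E, hE, hEn⟩ := hM
  let := CStarAlgebra.spectralOrder N.toStarSubalgebra
  let := CStarAlgebra.spectralOrderedRing N.toStarSubalgebra
  let ρ : N.toStarSubalgebra →⋆ₙₐ[ℂ] (H →L[ℂ] H) :=
    (M.toStarSubalgebra.subtype : M.toStarSubalgebra →⋆ₙₐ[ℂ] (H →L[ℂ] H)).comp π
  obtain ⟨ψ, hψ, hψn⟩ := CompletelyPositiveMap.exists_extension N.toStarSubalgebra.subtype
    Subtype.val_injective (CompletelyPositiveMapClass.toCompletelyPositiveLinearMap ρ)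
  -- `π` need not be unital, but `‖ρ 1‖ ≤ 1` is enough for the Arveson extension to be contractive.
  have hψn' : ∀ b, ‖ψ b‖ ≤ ‖b‖ := fun b => by
    refine (hψn b).trans (mul_le_of_le_one_left (norm_nonneg b) ?_)
    refine (NonUnitalStarAlgHom.norm_apply_le ρ 1).trans ?_
    exact ContinuousLinearMap.norm_id_le
  let F₀ : (K →L[ℂ] K) →ₗ[ℂ] M.toStarSubalgebra :=
    (E ∘ₗ ψ.toLinearMap).codRestrict M.toSubspace fun x => hE.mem _
  have hF : ∀ x, ∃ a, π a = Q (F₀ x) := fun x => (Q (F₀ x)).2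
  choose F hF using hF
  -- The projection is `π⁻¹ ∘ Q ∘ E ∘ ψ`; `π` is isometric, so only `E` contributes to the norm
  -- bound.
  let P : (K →L[ℂ] K) →ₗ[ℂ] K →L[ℂ] K := N.toSubspace.subtype ∘ₗ
    { toFun := F
      map_add' := fun x y => hπ (by
        rw [hF]
        refine Eq.trans ?_ (map_add π (F x) (F y)).symm
        rw [hF, hF, map_add, map_add]
        rfl)
      map_smul' := fun c x => hπ (by
        rw [hF]
        refine Eq.trans ?_ (map_smul π c (F x)).symm
        rw [hF, map_smul, map_smul]
        rfl) }
  refine ⟨P, ⟨fun x => (F x).2, fun x hx => ?_⟩, fun x => ?_⟩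
  · have h1 : F₀ x = π ⟨x, hx⟩ := Subtype.ext <| by
      have h2 : ψ x = π ⟨x, hx⟩ := hψ ⟨x, hx⟩
      change E (ψ x) = _
      rw [h2]
      exact hE.eq_self _ (π ⟨x, hx⟩).2
    have h3 : F x = ⟨x, hx⟩ := hπ <| by
      rw [hF, h1]
      exact congrArg Subtype.val (hQ ⟨π ⟨x, hx⟩, ⟨⟨x, hx⟩, rfl⟩⟩)
    exact congrArg Subtype.val h3
  · have h1 : ‖F x‖ = ‖π (F x)‖ := (NonUnitalStarAlgHom.norm_map π hπ (F x)).symm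
    calc ‖P x‖ = ‖F x‖ := rfl
      _ = ‖Q (F₀ x)‖ := by rw [h1, hF]; rfl
      _ ≤ ‖F₀ x‖ := (Q.le_opNorm _).trans (mul_le_of_le_one_left (norm_nonneg _) hQn)
      _ = ‖E (ψ x)‖ := rfl
      _ ≤ C * ‖ψ x‖ := hEn _
      _ ≤ C * ‖x‖ := mul_le_mul_of_nonneg_left (hψn' x) hC

theorem hasProjection_of_clm {P : (H →L[ℂ] H) →L[ℂ] M.toSubspace} (hP : ∀ x : M.toSubspace, P x = x) :
    M.HasProjection ‖P‖ :=
  ⟨M.toSubspace.subtype ∘ₗ P.toLinearMap,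
    ⟨fun x => (P x).2, fun x hx => congrArg Subtype.val (hP ⟨x, hx⟩)⟩, P.le_opNorm⟩

theorem HasProjection.contractivelyComplemented (h : M.HasProjection 1) :
    ContractivelyComplemented M.toSubspace := by
  obtain ⟨E, hE, hEn⟩ := h
  let P : (H →L[ℂ] H) →ₗ[ℂ] M.toSubspace := E.codRestrict M.toSubspace hE.mem
  exact ⟨P.mkContinuous 1 hEn, fun x => Subtype.ext (hE.eq_self x x.2),
    P.mkContinuous_norm_le zero_le_one hEn⟩

theorem one_le_enorm_of_projection [Nontrivial H] {P : (H →L[ℂ] H) →L[ℂ] M.toSubspace}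
    (hP : ∀ x : M.toSubspace, P x = x) : 1 ≤ ‖P‖ₑ := by
  let e : M.toSubspace := ⟨1, one_mem M⟩
  have he : ‖e‖ = 1 := norm_one (α := H →L[ℂ] H)
  have h1 := P.le_opNorm e
  rw [hP] at h1
  change ‖e‖ ≤ ‖P‖ * ‖e‖ at h1
  rw [he, mul_one] at h1
  rw [← ofReal_norm]
  exact ENNReal.one_le_ofReal.mpr h1

end VonNeumannAlgebra

end

open VonNeumannAlgebra in
theorem theorem1 {H : Type u} [NormedAddCommGroup H] [InnerProductSpace ℂ H] [CompleteSpace H]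
    (M : VonNeumannAlgebra H)
    (hM : Nonempty (M.toStarSubalgebra ≃⋆ₐ[ℂ] (M.tensor M).toStarSubalgebra) ∨
      (M.tensor M).EmbedsContractivelyComplemented M) :
    (M.toSubspace.ClosedComplemented →
      ContractivelyComplemented M.toSubspace ∧ VonNeumannAlgebra.IsInjective.{u, w} M) ∧
    (Nontrivial H →
      projectionConstant M.toSubspace = 1 ∨ projectionConstant M.toSubspace = ⊤) := by
  have hemb : (M.tensor M).EmbedsContractivelyComplemented M :=
    hM.elim (fun ⟨e⟩ => embedsContractivelyComplemented_of_starAlgEquiv e) id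
  have key : M.toSubspace.ClosedComplemented → ContractivelyComplemented M.toSubspace := by
    rintro ⟨P, hP⟩
    exact ((hasProjection_of_clm hP).one_of_tensor (norm_nonneg P) fun C hC hC' =>
      hC'.of_embedsContractivelyComplemented hemb hC).contractivelyComplemented
  refine ⟨fun h => ⟨key h, isInjective_of_contractivelyComplemented (key h)⟩, fun _ => ?_⟩
  by_cases h : M.toSubspace.ClosedComplemented
  · obtain ⟨P, hP, hPn⟩ := key h
    refine Or.inl (le_antisymm ?_ (le_iInf₂ fun P hP => one_le_enorm_of_projection hP))
    refine (iInf₂_le P hP).trans ?_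
    rw [← ofReal_norm]
    exact ENNReal.ofReal_le_one.mpr hPn
  · exact Or.inr (iInf₂_eq_top.mpr fun P hP => absurd ⟨P, hP⟩ h)
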